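/- For an odd prime $q$ let $\sum^{+}_{\chi \bmod q}$ and $\sum^{-}_{\chi \bmod q}$ denote the sums over the even, respectively odd, primitive Dirichlet characters $\chi$ modulo $q$, let $L(s,\chi)$ be the (analytically continued) Dirichlet $L$-function of $\chi$, let $\zeta$ be the Riemann zeta function, and let $\gamma$ be Euler's constant. There are real constants $c_1, c_2, \dots$ and $c_1', c_2', \dots$ (independent of $q$ and $N$) such that for every integer $N \ge 1$ and every odd prime $q$ $$\sum_{\chi \bmod q}^{+} |L(\tfrac12,\chi)|^2 = \frac{q-1}{2}\Big(\log\frac{q}{8\pi} + \gamma - \frac{\pi}{2}\Big) + 2\zeta(\tfrac12)^2 q^{1/2} - 2\zeta(\tfrac12)^2 + \sum_{n=1}^{N} c_n q^{-n/2} + O_N\big(q^{-(N+1)/2}\big),$$ $$\sum_{\chi \bmod q}^{-} |L(\tfrac12,\chi)|^2 = \frac{q-1}{2}\Big(\log\frac{q}{8\pi} + \gamma + \frac{\pi}{2}\Big) + \sum_{n=1}^{N} c_n' q^{-n/2} + O_N\big(q^{-(N+1)/2}\big),$$ where the implied constants depend only on $N$. -/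

import Mathlib

open scoped Classical in
/-- `∑⁺_{χ mod q} |L(1/2, χ)|²`: the second moment over the even primitive characters mod `q`. -/
noncomputable def evenSecondMoment (q : ℕ) [NeZero q] : ℝ :=
  ∑ χ : DirichletCharacter ℂ q with χ.IsPrimitive ∧ χ.Even,
    ‖DirichletCharacter.LFunction χ (1 / 2)‖ ^ 2

open scoped Classical in
/-- `∑⁻_{χ mod q} |L(1/2, χ)|²`: the second moment over the odd primitive characters mod `q`. -/
noncomputable def oddSecondMoment (q : ℕ) [NeZero q] : ℝ :=
  ∑ χ : DirichletCharacter ℂ q with χ.IsPrimitive ∧ χ.Odd,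
    ‖DirichletCharacter.LFunction χ (1 / 2)‖ ^ 2

open MeasureTheory intervalIntegral HurwitzZeta Filter Topology
open scoped ComplexConjugate

/-! For prime `q` every nonprincipal character is primitive, and `q ^ s * L(s, χ)` is the sum of
`χ(n)` times the even or odd Hurwitz zeta value at `n / q`, according to the parity of `χ`.
Plancherel over all characters (`DirichletCharacter.sum_norm_sq_sum_mul`) turns the moment into `(q
- 1) / (4 * q) * ∑ h(n / q)` over `1 ≤ n < q`, where `h(x)` is the square of `ζ(1/2, x) ± ζ(1/2, 1 -
x)`. In the even case the principal character must be subtracted; its term is `((1 - q ^ (-1/2)) *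
ζ(1/2)) ^ 2`.

The function `h` is 1-periodic and smooth except at the integers, where `h(x) = |x|⁻¹ + |x| ^ (p -
1/2) * A(x ^ 2) + B(x ^ 2)` with `A`, `B` power series and `p = 0` (even) or `p = 1` (odd). The
singular terms are removed by functions with the same singularities whose sums over `n / q` are
known exactly: `|x| ^ (-s)` by `2 * hurwitzZetaEven x s`, whose sum is `2 * (q ^ s - 1) * ζ(s)`
(`sum_hurwitzZetaEven`), and `|x|⁻¹` by the constant term of the same function at `s = 1`
(`sum_evenDigamma`). What is left is `C ^ (2M)` and periodic, so its Riemann sum is `q` times its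
integral up to `O(q ^ (1 - 2M))`. This is `exists_sum_sub_le_of_singular`; the half-integral powers
of `q` come from the exact sums.

There remains the coefficient of `q`, the integral over `[0, 1/2]` of `h(x) - 1 / x`. With `1/2`
replaced by a complex `s`, it becomes the integral of `(ζ(s, x) ± ζ(s, 1 - x)) ^ 2 - x ^ (-2s)`,
which is holomorphic for `Re s < 1`. For `Re s < 0` the functional equation and Parseval evaluate
the squared part in terms of `Γ(1 - s) ^ 2 * ζ(2 - 2s)` and `cos ^ 2` or `sin ^ 2` of `π * (1 - s) /
2`. The two poles at `s = 1/2` cancel and the value there is a derivative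
(`regularizedIntegral_one_half`): `γ` drops out, `cos ^ 2` gives `-π / 2` and `sin ^ 2` gives `+π /
2`. -/

/-! ### Taylor expansion of the Hurwitz zeta function, uniformly in `s`. -/

theorem choose_succ_eq_mul_div {R : Type*} [Field R] [CharZero R] [BinomialRing R] (a : R) (k : ℕ) :
    Ring.choose a (k + 1) = Ring.choose a k * (a - k) / (k + 1) := by
  have h := Ring.choose_smul_choose a (n := k + 1) (k := k) (by omega)
  have h2 : k + 1 - k = 1 := by omega
  rw [Nat.choose_succ_self_right, h2, Ring.choose_one_right, nsmul_eq_mul] at h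
  have hk : ((k : R) + 1) ≠ 0 := by exact_mod_cast Nat.succ_ne_zero k
  rw [eq_div_iff hk, ← h]
  push_cast
  ring

/-- Taylor coefficients of `x ↦ ζ(s, 1 + x) - 1 / (s - 1)` at the origin, as entire functions
of `s`. -/
noncomputable def hurwitzCoeff : ℕ → ℂ → ℂ
  | 0, s => riemannZeta₀ s
  | k + 1, s => -(Ring.choose (-s) k * riemannZeta₁ (s + k + 1) / (k + 1))

theorem differentiable_choose_neg (k : ℕ) : Differentiable ℂ fun s : ℂ => Ring.choose (-s) k := by
  induction k with
  | zero => simp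
  | succ k ih =>
    simp_rw [choose_succ_eq_mul_div]
    fun_prop

theorem differentiable_hurwitzCoeff (k : ℕ) : Differentiable ℂ (hurwitzCoeff k) := by
  cases k with
  | zero => exact differentiable_riemannZeta₀
  | succ k =>
    unfold hurwitzCoeff
    have := differentiable_choose_neg k
    fun_prop

/-- For `k ≥ 1` the pole of `ζ(s + k)` at `s = 1 - k` is cancelled by the last factor `-s - (k - 1)`
of the binomial coefficient, so only `k = 0` keeps a pole. This is why `hurwitzCoeff` is written
with `riemannZeta₁`, the entire function `(s - 1) * ζ(s)`. -/
theorem hurwitzCoeff_of_one_lt_re {s : ℂ} (hs : 1 < s.re) (k : ℕ) :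
    Ring.choose (-s) k * riemannZeta (s + k) =
      hurwitzCoeff k s + if k = 0 then 1 / (s - 1) else 0 := by
  cases k with
  | zero =>
    have : s ≠ 1 := by rintro rfl; simp at hs
    simp [hurwitzCoeff, riemannZeta_eq_inv_sub_add this, add_comm]
  | succ k =>
    have h1 : s + ((k + 1 : ℕ) : ℂ) ≠ 1 := by
      intro h
      have := congrArg Complex.re h
      simp at this
      have hk : (0 : ℝ) ≤ k := by positivity
      linarith
    have h2 : s + ((k + 1 : ℕ) : ℂ) - 1 ≠ 0 := sub_ne_zero.mpr h1
    have h3 : ((k : ℂ) + 1) ≠ 0 := by exact_mod_cast Nat.succ_ne_zero k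
    rw [riemannZeta_eq_inv_sub_mul h1, choose_succ_eq_mul_div]
    have h4 : s + ((k + 1 : ℕ) : ℂ) - 1 = s + k := by push_cast; ring
    rw [h4] at h2 ⊢
    simp only [hurwitzCoeff, if_false, add_zero, Nat.cast_add, Nat.cast_one,
      add_eq_zero, one_ne_zero, and_false]
    rw [add_assoc s]
    field_simp
    ring

/-- The binomial coefficient `(-1)^k * choose (-B) k`. -/
noncomputable def negChooseBound (B : ℝ) : ℕ → ℝ
  | 0 => 1
  | k + 1 => negChooseBound B k * (B + k) / (k + 1)

theorem negChooseBound_pos {B : ℝ} (hB : 0 < B) (k : ℕ) : 0 < negChooseBound B k := by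
  induction k with
  | zero => simp [negChooseBound]
  | succ k ih => unfold negChooseBound; positivity

theorem norm_choose_neg_le {B : ℝ} (hB : 0 < B) {s : ℂ} (hs : ‖s‖ ≤ B) (k : ℕ) :
    ‖Ring.choose (-s) k‖ ≤ negChooseBound B k := by
  induction k with
  | zero => simp [negChooseBound]
  | succ k ih =>
    rw [choose_succ_eq_mul_div, norm_div, norm_mul]
    unfold negChooseBound
    have h1 : ‖(k : ℂ) + 1‖ = k + 1 := by
      rw [← Nat.cast_one, ← Nat.cast_add, Complex.norm_natCast]; simp
    rw [h1]
    have h2 : ‖-s - (k : ℂ)‖ ≤ B + k := by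
      refine (norm_sub_le _ _).trans ?_
      simpa using hs
    have := negChooseBound_pos hB k
    gcongr

theorem summable_negChooseBound {B r : ℝ} (hB : 0 < B) (hr : 0 ≤ r) (hr1 : r < 1) :
    Summable fun k => negChooseBound B k * r ^ k := by
  rcases hr.eq_or_lt with rfl | hr0
  · refine summable_of_ne_finset_zero (s := {0}) fun k hk => ?_
    rw [zero_pow (by simpa using hk), mul_zero]
  refine summable_of_ratio_test_tendsto_lt_one hr1 (Filter.Eventually.of_forall fun k => ?_) ?_
  · have := negChooseBound_pos hB k
    positivity
  have h : ∀ k : ℕ, ‖negChooseBound B (k + 1) * r ^ (k + 1)‖ / ‖negChooseBound B k * r ^ k‖ =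
      (1 + (B - 1) * (1 / ((k : ℝ) + 1))) * r := by
    intro k
    have h0 := negChooseBound_pos hB k
    have h1 := negChooseBound_pos hB (k + 1)
    rw [Real.norm_of_nonneg (by positivity), Real.norm_of_nonneg (by positivity), negChooseBound]
    field_simp
    ring
  simp_rw [h]
  have := ((tendsto_one_div_add_atTop_nhds_zero_nat (𝕜 := ℝ)).const_mul (B - 1)).const_add 1
  simpa using this.mul_const r

theorem exists_norm_riemannZeta_le : ∃ C : ℝ, 0 < C ∧ ∀ s : ℂ, 2 ≤ s.re → ‖riemannZeta s‖ ≤ C := by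
  have hsum : Summable fun n : ℕ => 1 / ((n : ℝ) + 1) ^ (2 : ℕ) := by
    simpa using (summable_nat_add_iff 1).mpr (Real.summable_one_div_nat_pow.mpr one_lt_two)
  refine ⟨∑' n : ℕ, 1 / ((n : ℝ) + 1) ^ (2 : ℕ), ?_, fun s hs => ?_⟩
  · exact hsum.tsum_pos (fun n => by positivity) 0 (by norm_num)
  · rw [zeta_eq_tsum_one_div_nat_add_one_cpow (by linarith)]
    refine tsum_of_norm_bounded hsum.hasSum fun n => ?_
    have : (n : ℂ) + 1 = ((n + 1 : ℝ) : ℂ) := by push_cast; ring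
    rw [norm_div, norm_one, this, Complex.norm_cpow_eq_rpow_re_of_pos (by positivity)]
    refine one_div_le_one_div_of_le (by positivity) ?_
    rw [← Real.rpow_natCast]
    exact Real.rpow_le_rpow_of_exponent_le (by linarith [n.cast_nonneg (α := ℝ)]) (by simpa using hs)

/-- The majorant is uniform on discs in `s`; this makes the series holomorphic or continuous in `s`
and lets identities proved for `Re s > 1` be continued. -/
theorem exists_summable_hurwitzCoeff_bound (B : ℝ) {r : ℝ} (hr : 0 ≤ r) (hr1 : r < 1) :
    ∃ u : ℕ → ℝ, Summable u ∧ ∀ s : ℂ, ‖s‖ ≤ B → ∀ k, ‖hurwitzCoeff k s‖ * r ^ k ≤ u k := by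
  rcases le_or_gt B 0 with hB | hB
  · refine ⟨fun k => ‖hurwitzCoeff k 0‖ * r ^ k, ?_, fun s hs k => ?_⟩
    · obtain ⟨C, hC, hCb⟩ := exists_norm_riemannZeta_le
      refine summable_of_ne_finset_zero (s := {0, 1}) fun k hk => ?_
      simp only [Finset.mem_insert, Finset.mem_singleton, not_or] at hk
      obtain ⟨j, rfl⟩ : ∃ j, k = j + 2 := ⟨k - 2, by omega⟩
      have : Ring.choose (-0 : ℂ) (j + 1) = 0 := by
        rw [neg_zero, Ring.choose_zero_succ]
      rw [hurwitzCoeff, this]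
      simp
    · have : s = 0 := norm_le_zero_iff.mp (hs.trans hB)
      rw [this]
  obtain ⟨C, hC, hCb⟩ := exists_norm_riemannZeta_le
  have hM : ∀ k, ∃ M, ∀ s : ℂ, ‖s‖ ≤ B → ‖hurwitzCoeff k s‖ ≤ M := fun k => by
    obtain ⟨M, hM⟩ := (isCompact_closedBall (0 : ℂ) B).exists_bound_of_continuousOn
      (differentiable_hurwitzCoeff k).continuous.continuousOn
    exact ⟨M, fun s hs => hM s (by simpa using hs)⟩
  choose M hM using hM
  -- From index `K` on, `Re (s + k) ≥ 2`, where `ζ` is bounded; the finitely many earlier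
  -- coefficients are bounded by compactness.
  obtain ⟨K, hK⟩ := exists_nat_gt (B + 2)
  refine ⟨fun k => if k < K then M k * r ^ k else C * (negChooseBound B k * r ^ k), ?_, ?_⟩
  · refine ((summable_negChooseBound hB hr hr1).mul_left C).congr_cofinite ?_
    refine (Set.finite_lt_nat K).subset fun k hk => ?_
    by_contra h
    simp only [Set.mem_ofPred_eq, not_lt] at h
    exact hk (by simp [not_lt.mpr h])
  · intro s hs k
    dsimp only
    split_ifs with hk
    · gcongr; exact hM k s hs
    · rw [← mul_assoc]
      gcongr
      push Not at hk
      cases k with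
      | zero =>
        have : (K : ℝ) ≤ 0 := by exact_mod_cast hk
        linarith
      | succ k =>
        have hkK : (K : ℝ) ≤ k + 1 := by exact_mod_cast hk
        have hre : 2 ≤ (s + k + 1).re := by
          have := (abs_le.mp ((Complex.abs_re_le_norm s).trans hs)).1
          simp
          linarith
        have hne : s + k + 1 ≠ 1 := by
          intro h
          rw [h] at hre
          norm_num at hre
        have h1 : ‖riemannZeta₁ (s + k + 1)‖ ≤ (B + k) * C := by
          have h2 := riemannZeta_eq_inv_sub_mul hne
          have h3 : riemannZeta₁ (s + k + 1) = (s + k) * riemannZeta (s + k + 1) := by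
            rw [h2]
            have : s + k + 1 - 1 ≠ 0 := sub_ne_zero.mpr hne
            have h5 : s + k ≠ 0 := by simpa using this
            rw [add_sub_cancel_right]
            field_simp
          rw [h3, norm_mul]
          have h6 : ‖s + (k : ℂ)‖ ≤ B + k := (norm_add_le _ _).trans (by simpa using hs)
          have h7 := hCb _ hre
          gcongr
        have h8 := norm_choose_neg_le hB hs k
        have h9 := negChooseBound_pos hB k
        have h10 : ‖(k : ℂ) + 1‖ = k + 1 := by
          rw [← Nat.cast_one, ← Nat.cast_add, Complex.norm_natCast]; simp
        rw [hurwitzCoeff, negChooseBound, norm_neg, norm_div, norm_mul, h10]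
        calc ‖Ring.choose (-s) k‖ * ‖riemannZeta₁ (s + k + 1)‖ / (k + 1)
            ≤ negChooseBound B k * ((B + k) * C) / (k + 1) := by gcongr
          _ = _ := by ring

theorem hasSum_choose_mul_pow (a : ℂ) {z : ℂ} (hz : ‖z‖ < 1) :
    HasSum (fun k => Ring.choose a k * z ^ k) ((1 + z) ^ a) := by
  have h := (Complex.one_add_cpow_hasFPowerSeriesOnBall_zero (a := a)).hasSum (y := z)
    (by simpa [← ENNReal.coe_one, enorm_eq_nnnorm, ← NNReal.coe_lt_coe] using hz)
  simpa [binomialSeries, FormalMultilinearSeries.coeff_ofScalars, mul_comm] using h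

/-- Expand `(n + 1 + x) ^ (-s) = (n + 1) ^ (-s) * (1 + x / (n + 1)) ^ (-s)` by the binomial series
and exchange the sums: the rows of the double series return the terms, the columns give `ζ(s + k)`.
-/
theorem hasSum_hurwitz_shift {s : ℂ} (hs : 1 < s.re) {x : ℝ} (hx : |x| < 1) :
    HasSum (fun n : ℕ => 1 / ((n : ℂ) + 1 + x) ^ s)
      (1 / (s - 1) + ∑' k, hurwitzCoeff k s * (x : ℂ) ^ k) := by
  set f : ℕ × ℕ → ℂ := fun p => Ring.choose (-s) p.2 * (x : ℂ) ^ p.2 *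
    (1 / ((p.1 : ℂ) + 1) ^ (s + p.2)) with hf
  have hB : 0 < ‖s‖ := norm_pos_iff.mpr (by rintro rfl; norm_num at hs)
  have hnorm : ∀ (n k : ℕ), ‖1 / ((n : ℂ) + 1) ^ (s + k)‖ ≤ 1 / ((n : ℝ) + 1) ^ s.re := by
    intro n k
    have : (n : ℂ) + 1 = ((n + 1 : ℝ) : ℂ) := by push_cast; ring
    rw [norm_div, norm_one, this, Complex.norm_cpow_eq_rpow_re_of_pos (by positivity)]
    refine one_div_le_one_div_of_le (by positivity) ?_
    exact Real.rpow_le_rpow_of_exponent_le (by linarith [n.cast_nonneg (α := ℝ)]) (by simp)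
  have hs1 : Summable fun n : ℕ => 1 / ((n : ℝ) + 1) ^ s.re := by
    simpa using (summable_nat_add_iff 1).mpr (Real.summable_one_div_nat_rpow.mpr hs)
  have hs2 := summable_negChooseBound hB (abs_nonneg x) hx
  have hsum : Summable f := by
    refine .of_norm_bounded (hs1.mul_of_nonneg hs2 (fun n => by dsimp only; positivity)
      (fun k => by have := negChooseBound_pos hB k; dsimp only; positivity)) fun p => ?_
    rw [hf, mul_comm]
    dsimp only
    rw [norm_mul, norm_mul, norm_pow, Complex.norm_real, Real.norm_eq_abs]
    have h1 := hnorm p.1 p.2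
    have h2 := norm_choose_neg_le hB le_rfl p.2
    have h3 := negChooseBound_pos hB p.2
    gcongr
  have hrow : ∀ n : ℕ, HasSum (fun k => f (n, k)) (1 / ((n : ℂ) + 1 + x) ^ s) := by
    intro n
    have hn : (0 : ℝ) < n + 1 := by positivity
    have hz : ‖((x / (n + 1) : ℝ) : ℂ)‖ < 1 := by
      rw [Complex.norm_real, Real.norm_eq_abs, abs_div, abs_of_pos hn, div_lt_one hn]
      linarith [n.cast_nonneg (α := ℝ)]
    have h := (hasSum_choose_mul_pow (-s) hz).mul_left ((((n : ℝ) + 1 : ℝ) : ℂ) ^ (-s))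
    have hpos : (0 : ℝ) < 1 + x / (n + 1) := by
      have := (abs_lt.mp (by rwa [Complex.norm_real, Real.norm_eq_abs] at hz)).1
      linarith
    convert! h using 1
    · funext k
      rw [hf]
      dsimp only
      have hne : (((n : ℝ) + 1 : ℝ) : ℂ) ≠ 0 := by exact_mod_cast hn.ne'
      have hc : (n : ℂ) + 1 = (((n : ℝ) + 1 : ℝ) : ℂ) := by push_cast; ring
      rw [hc, Complex.cpow_add _ _ hne, Complex.cpow_natCast, Complex.cpow_neg, Complex.ofReal_div,
        div_pow, one_div, mul_inv]
      ring
    · rw [show (1 : ℂ) + ((x / (n + 1) : ℝ) : ℂ) = ((1 + x / (n + 1) : ℝ) : ℂ) by push_cast; ring,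
        ← Complex.mul_cpow_ofReal_nonneg hn.le hpos.le, Complex.cpow_neg, one_div]
      congr 2
      rw [← Complex.ofReal_mul]
      have : ((n : ℝ) + 1) * (1 + x / (n + 1)) = n + 1 + x := by field_simp
      rw [this]
      push_cast
      ring
  have hcol : ∀ k : ℕ, HasSum (fun n => f (n, k))
      (hurwitzCoeff k s * (x : ℂ) ^ k + if k = 0 then 1 / (s - 1) else 0) := by
    intro k
    have hk : 1 < (s + k).re := by simp; linarith [k.cast_nonneg (α := ℝ)]
    have h1 : Summable fun n : ℕ => 1 / ((n : ℂ) + 1) ^ (s + k) :=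
      .of_norm_bounded hs1 fun n => hnorm n k
    have h2 := h1.hasSum.mul_left (Ring.choose (-s) k * (x : ℂ) ^ k)
    rw [← zeta_eq_tsum_one_div_nat_add_one_cpow hk] at h2
    convert! h2 using 1
    rw [mul_right_comm, hurwitzCoeff_of_one_lt_re hs]
    split_ifs with h0
    · subst h0; simp
    · ring
  have htot := hsum.hasSum
  have e1 := htot.prod_fiberwise hrow
  have e2 := ((Equiv.prodComm ℕ ℕ).hasSum_iff.mpr htot).prod_fiberwise (g := fun k =>
    hurwitzCoeff k s * (x : ℂ) ^ k + if k = 0 then 1 / (s - 1) else 0) hcol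
  have e3 : Summable fun k => hurwitzCoeff k s * (x : ℂ) ^ k := by
    obtain ⟨u, hu, hub⟩ := exists_summable_hurwitzCoeff_bound ‖s‖ (abs_nonneg x) hx
    refine .of_norm_bounded hu fun k => ?_
    simpa using hub s le_rfl k
  have e4 := e3.hasSum.add (hasSum_ite_eq 0 (1 / (s - 1)))
  rw [add_comm, ← e2.unique e4]
  exact e1

/-! ### Even and odd Hurwitz zeta functions as a singular power plus a series in `x ^ 2`. -/

/-- The coefficient sequences whose power series has radius of convergence at least one. -/
def RadiusGeOne (a : ℕ → ℂ) : Prop :=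
  ∀ r : ℝ, 0 ≤ r → r < 1 → Summable fun k => ‖a k‖ * r ^ k

/-- The sum of the power series with coefficients `a`. -/
noncomputable def powSum (a : ℕ → ℂ) (y : ℂ) : ℂ := ∑' k, a k * y ^ k

theorem RadiusGeOne.summable {a : ℕ → ℂ} (ha : RadiusGeOne a) {y : ℂ} (hy : ‖y‖ < 1) :
    Summable fun k => a k * y ^ k :=
  .of_norm (by simpa using ha ‖y‖ (norm_nonneg y) hy)

theorem powSum_zero (a : ℕ → ℂ) : powSum a 0 = a 0 := by
  rw [powSum, tsum_eq_single 0 fun k hk => by simp [hk]]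
  simp

/-- Even (`p = 0`) or odd (`p = 1`) Taylor coefficients of `ζ(s, 1 + x) ± ζ(s, 1 - x)`. -/
noncomputable def signedCoeff (p : ℕ) (s : ℂ) (k : ℕ) : ℂ := 2 * hurwitzCoeff (2 * k + p) s

theorem exists_summable_signedCoeff_bound (p : ℕ) (B : ℝ) {r : ℝ} (hr : 0 ≤ r) (hr1 : r < 1) :
    ∃ u : ℕ → ℝ, Summable u ∧ ∀ s : ℂ, ‖s‖ ≤ B → ∀ k, ‖signedCoeff p s k‖ * r ^ k ≤ u k := by
  -- The floor `1/4` only keeps `√t` positive, so that `√t ^ p` can be divided out when `√t ^ (2 * k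
  -- + p)` is compared with `r ^ k`.
  set t := max r (1 / 4) with ht
  have ht0 : 0 < t := lt_of_lt_of_le (by norm_num) (le_max_right _ _)
  have ht1 : t < 1 := max_lt hr1 (by norm_num)
  obtain ⟨u, hu, hub⟩ := exists_summable_hurwitzCoeff_bound B (Real.sqrt_nonneg t)
    (by rw [Real.sqrt_lt' one_pos]; simpa using ht1)
  have hst : 0 < √t := Real.sqrt_pos.mpr ht0
  refine ⟨fun k => 2 * u (2 * k + p) * (√t ^ p)⁻¹, ?_, fun s hs k => ?_⟩
  · have hinj : Function.Injective fun k : ℕ => 2 * k + p := fun a b h => by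
      dsimp only at h; omega
    exact ((hu.comp_injective hinj).mul_left 2).mul_right _
  · dsimp only
    have h := hub s hs (2 * k + p)
    rw [pow_add, pow_mul, Real.sq_sqrt ht0.le] at h
    rw [← div_eq_mul_inv, le_div_iff₀ (by positivity), signedCoeff, norm_mul, Complex.norm_ofNat]
    have h2 : r ^ k ≤ t ^ k := pow_le_pow_left₀ hr (le_max_left _ _) k
    calc 2 * ‖hurwitzCoeff (2 * k + p) s‖ * r ^ k * √t ^ p
        ≤ 2 * ‖hurwitzCoeff (2 * k + p) s‖ * t ^ k * √t ^ p := by gcongr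
      _ = 2 * (‖hurwitzCoeff (2 * k + p) s‖ * (t ^ k * √t ^ p)) := by ring
      _ ≤ _ := by gcongr

theorem radiusGeOne_signedCoeff (p : ℕ) (s : ℂ) : RadiusGeOne (signedCoeff p s) := by
  intro r hr hr1
  obtain ⟨u, hu, hub⟩ := exists_summable_signedCoeff_bound p ‖s‖ hr hr1
  exact .of_nonneg_of_le (fun k => by positivity) (fun k => hub s le_rfl k) hu

theorem differentiable_powSum_signedCoeff (p : ℕ) {y : ℂ} (hy : ‖y‖ < 1) :
    Differentiable ℂ fun s => powSum (signedCoeff p s) y := by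
  intro s
  obtain ⟨u, hu, hub⟩ := exists_summable_signedCoeff_bound p (‖s‖ + 1) (norm_nonneg y) hy
  have hd : DifferentiableOn ℂ (fun s => powSum (signedCoeff p s) y) (Metric.ball 0 (‖s‖ + 1)) := by
    refine Complex.differentiableOn_tsum_of_summable_norm hu (fun k => ?_) Metric.isOpen_ball ?_
    · have := differentiable_hurwitzCoeff (2 * k + p)
      unfold signedCoeff
      fun_prop
    · intro k w hw
      rw [norm_mul, norm_pow]
      exact hub w (by simpa using (mem_ball_zero_iff.mp hw).le) k
  exact hd.differentiableAt (Metric.isOpen_ball.mem_nhds (by simp))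

theorem norm_ofReal_sq_lt_one {x : ℝ} (hx : |x| < 1) : ‖(x : ℂ) ^ 2‖ < 1 := by
  rw [norm_pow, Complex.norm_real, Real.norm_eq_abs]
  exact pow_lt_one₀ (abs_nonneg x) hx two_ne_zero

theorem hurwitzCoeff_tsum_split (s : ℂ) {x : ℝ} (hx : |x| < 1) :
    ∑' k, hurwitzCoeff k s * (x : ℂ) ^ k = powSum (signedCoeff 0 s) (x ^ 2) / 2 +
      x * powSum (signedCoeff 1 s) (x ^ 2) / 2 := by
  have h0 := (radiusGeOne_signedCoeff 0 s).summable (norm_ofReal_sq_lt_one hx)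
  have h1 := (radiusGeOne_signedCoeff 1 s).summable (norm_ofReal_sq_lt_one hx)
  have e0 : ∀ k, hurwitzCoeff (2 * k) s * (x : ℂ) ^ (2 * k) =
      signedCoeff 0 s k * ((x : ℂ) ^ 2) ^ k / 2 := fun k => by
    rw [signedCoeff, ← pow_mul, add_zero]; ring
  have e1 : ∀ k, hurwitzCoeff (2 * k + 1) s * (x : ℂ) ^ (2 * k + 1) =
      x * (signedCoeff 1 s k * ((x : ℂ) ^ 2) ^ k) / 2 := fun k => by
    rw [signedCoeff, ← pow_mul]; ring
  rw [← tsum_even_add_odd (f := fun k => hurwitzCoeff k s * (x : ℂ) ^ k)]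
  · simp_rw [e0, e1, powSum]
    rw [tsum_div_const, tsum_div_const, tsum_mul_left]
  · simp_rw [e0]; exact h0.div_const 2
  · simp_rw [e1]; exact (h1.mul_left _).div_const 2

/-- The values `ε = 1` and `ε = -1` give the even and the odd combination, in which one parity of
Taylor coefficients cancels. -/
theorem hurwitz_shift_pair {s : ℂ} (hs : 1 < s.re) {x : ℝ} (hx : |x| < 1) (ε : ℂ) :
    HasSum (fun n : ℕ => 1 / ((n : ℂ) + x) ^ s + ε * (1 / ((n : ℂ) + 1 - x) ^ s))
      ((x : ℂ) ^ (-s) + (1 + ε) * (1 / (s - 1) + powSum (signedCoeff 0 s) (x ^ 2) / 2) +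
        (1 - ε) * (x * powSum (signedCoeff 1 s) (x ^ 2) / 2)) := by
  have h1 := hasSum_hurwitz_shift hs hx
  have h2 := hasSum_hurwitz_shift hs (x := -x) (by rwa [abs_neg])
  rw [hurwitzCoeff_tsum_split s hx] at h1
  rw [hurwitzCoeff_tsum_split s (x := -x) (by rwa [abs_neg])] at h2
  -- The shifted series starts at `1 + x`; the missing term at `n = 0` is the singular power `x ^
  -- (-s)`.
  have h3 : HasSum (fun n : ℕ => 1 / ((n : ℂ) + x) ^ s) _ :=
    HasSum.zero_add (f := fun n : ℕ => 1 / ((n : ℂ) + x) ^ s) (by exact_mod_cast h1)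
  have h4 := h3.add (h2.mul_left ε)
  convert! h4 using 1
  · funext n
    push_cast
    rw [← sub_eq_add_neg]
  · push_cast
    rw [neg_sq, zero_add, Complex.cpow_neg, one_div]
    ring

/-- The series gives this for `Re s > 1`; both sides are holomorphic on the connected set `ℂ ∖ {1}`,
so it persists at `s = 1/2` and at the negative exponents used later. -/
theorem two_mul_hurwitzZetaEven_of_pos {s : ℂ} (hs : s ≠ 1) {x : ℝ} (hx : 0 < x) (hx1 : x < 1) :
    2 * hurwitzZetaEven x s = (x : ℂ) ^ (-s) + 2 / (s - 1) + powSum (signedCoeff 0 s) (x ^ 2) := by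
  have habs : |x| < 1 := by rwa [abs_of_pos hx]
  have hx0 : (x : ℂ) ≠ 0 := by exact_mod_cast hx.ne'
  have hf : AnalyticOnNhd ℂ (fun s => 2 * hurwitzZetaEven x s) {1}ᶜ := by
    refine DifferentiableOn.analyticOnNhd (fun u hu => ?_) isOpen_compl_singleton
    exact ((differentiableAt_hurwitzZetaEven _ hu).const_mul 2).differentiableWithinAt
  have hg : AnalyticOnNhd ℂ (fun s => (x : ℂ) ^ (-s) + 2 / (s - 1) +
      powSum (signedCoeff 0 s) (x ^ 2)) {1}ᶜ := by
    refine DifferentiableOn.analyticOnNhd (fun u hu => ?_) isOpen_compl_singleton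
    have h0 : u - 1 ≠ 0 := sub_ne_zero.mpr hu
    have h1 := (differentiable_powSum_signedCoeff 0 (norm_ofReal_sq_lt_one habs)) u
    refine (((DifferentiableAt.const_cpow (by fun_prop) (Or.inl hx0)).add ?_).add
      h1).differentiableWithinAt
    exact (differentiableAt_const _).div (by fun_prop) h0
  have hV : {z : ℂ | 1 < z.re} ∈ nhds (2 : ℂ) :=
    (Complex.continuous_re.isOpen_preimage _ isOpen_Ioi).mem_nhds (by simp)
  refine hf.eqOn_of_preconnected_of_eventuallyEq hg
    (isConnected_compl_singleton_of_one_lt_rank (by simp) _).isPreconnected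
    (show (2 : ℂ) ∈ ({1}ᶜ : Set ℂ) by simp) ?_ hs
  filter_upwards [hV] with z hz
  have h1 := (hasSum_nat_hurwitzZetaEven_of_mem_Icc ⟨hx.le, hx1.le⟩ hz).mul_left 2
  have h2 := hurwitz_shift_pair hz habs 1
  refine h1.unique ?_
  convert! h2 using 1
  · funext n; ring
  · ring

theorem two_mul_hurwitzZetaEven {s : ℂ} (hs : s ≠ 1) {x : ℝ} (hx : x ≠ 0) (hx1 : |x| < 1) :
    2 * hurwitzZetaEven x s =
      ((|x| : ℝ) : ℂ) ^ (-s) + 2 / (s - 1) + powSum (signedCoeff 0 s) (x ^ 2) := by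
  have h := two_mul_hurwitzZetaEven_of_pos hs (abs_pos.mpr hx) hx1
  have h2 : ((|x| : ℝ) : ℂ) ^ 2 = (x : ℂ) ^ 2 := by
    rw [← Complex.ofReal_pow, sq_abs, Complex.ofReal_pow]
  rw [h2] at h
  rw [← h]
  rcases abs_choice x with hx | hx <;> rw [hx]
  rw [AddCircle.coe_neg, hurwitzZetaEven_neg]

theorem two_mul_hurwitzZetaOdd (s : ℂ) {x : ℝ} (hx : 0 < x) (hx1 : x < 1) :
    2 * hurwitzZetaOdd x s = (x : ℂ) ^ (-s) + x * powSum (signedCoeff 1 s) (x ^ 2) := by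
  have habs : |x| < 1 := by rwa [abs_of_pos hx]
  have hx0 : (x : ℂ) ≠ 0 := by exact_mod_cast hx.ne'
  have hf : AnalyticOnNhd ℂ (fun s => 2 * hurwitzZetaOdd x s) Set.univ :=
    ((differentiable_hurwitzZetaOdd _).const_mul 2).differentiableOn.analyticOnNhd isOpen_univ
  have hg : AnalyticOnNhd ℂ (fun s => (x : ℂ) ^ (-s) + x *
      powSum (signedCoeff 1 s) (x ^ 2)) Set.univ := by
    refine Differentiable.differentiableOn (fun u => ?_) |>.analyticOnNhd isOpen_univ
    have h1 := (differentiable_powSum_signedCoeff 1 (norm_ofReal_sq_lt_one habs)) u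
    exact (DifferentiableAt.const_cpow (by fun_prop) (Or.inl hx0)).add (h1.const_mul _)
  have hV : {z : ℂ | 1 < z.re} ∈ nhds (2 : ℂ) :=
    (Complex.continuous_re.isOpen_preimage _ isOpen_Ioi).mem_nhds (by simp)
  refine hf.eqOn_of_preconnected_of_eventuallyEq hg isPreconnected_univ
    (Set.mem_univ 2) ?_ (Set.mem_univ s)
  filter_upwards [hV] with z hz
  have h1 := (hasSum_nat_hurwitzZetaOdd_of_mem_Icc ⟨hx.le, hx1.le⟩ hz).mul_left 2
  have h2 := hurwitz_shift_pair hz habs (-1)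
  refine h1.unique ?_
  convert! h2 using 1
  · funext n; ring
  · ring

theorem RadiusGeOne.differentiableOn {a : ℕ → ℂ} (ha : RadiusGeOne a) :
    DifferentiableOn ℂ (powSum a) (Metric.ball 0 1) := by
  intro y hy
  rw [mem_ball_zero_iff] at hy
  obtain ⟨r, hr, hr1⟩ := exists_between hy
  have hd : DifferentiableOn ℂ (powSum a) (Metric.ball 0 r) := by
    refine Complex.differentiableOn_tsum_of_summable_norm
      (ha r ((norm_nonneg y).trans hr.le) hr1) (fun k => by fun_prop) Metric.isOpen_ball ?_
    intro k w hw
    rw [norm_mul, norm_pow]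
    have := (mem_ball_zero_iff.mp hw).le
    gcongr
  exact (hd.differentiableAt (Metric.isOpen_ball.mem_nhds (by simpa using hr))).differentiableWithinAt

theorem RadiusGeOne.contDiffAt {a : ℕ → ℂ} (ha : RadiusGeOne a) {n : WithTop ℕ∞} {x : ℝ}
    (hx : |x| < 1) : ContDiffAt ℝ n (fun x : ℝ => powSum a ((x : ℂ) ^ 2)) x := by
  have h1 : ContDiffAt ℂ n (powSum a) ((x : ℂ) ^ 2) :=
    (ha.differentiableOn.analyticAt (Metric.isOpen_ball.mem_nhds
      (by simpa using norm_ofReal_sq_lt_one hx))).contDiffAt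
  have h2 : ContDiffAt ℝ n (fun x : ℝ => (x : ℂ) ^ 2) x :=
    (Complex.ofRealCLM.contDiff.pow 2).contDiffAt
  exact (h1.restrict_scalars ℝ).comp x h2

theorem RadiusGeOne.continuousOn {a : ℕ → ℂ} (ha : RadiusGeOne a) :
    ContinuousOn (fun x : ℝ => powSum a ((x : ℂ) ^ 2)) (Set.Ioo (-1) 1) := fun _ hx =>
  (ha.contDiffAt (n := 0) (abs_lt.mpr hx)).continuousAt.continuousWithinAt

theorem uIcc_zero_half_subset : Set.uIcc (0 : ℝ) (1 / 2) ⊆ Set.Ioo (-1) 1 := by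
  rw [Set.uIcc_of_le (by norm_num)]
  intro x hx
  constructor <;> linarith [hx.1, hx.2]

theorem RadiusGeOne.intervalIntegrable {a : ℕ → ℂ} (ha : RadiusGeOne a) :
    IntervalIntegrable (fun x : ℝ => powSum a ((x : ℂ) ^ 2)) MeasureTheory.volume 0 (1 / 2) :=
  (ha.continuousOn.mono uIcc_zero_half_subset).intervalIntegrable

theorem RadiusGeOne.hasSum_integral {a : ℕ → ℂ} (ha : RadiusGeOne a) :
    HasSum (fun k => a k * ((1 / 2) ^ (2 * k + 1) / (2 * k + 1)))
      (∫ x in (0 : ℝ)..1 / 2, powSum a ((x : ℂ) ^ 2)) := by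
  have hc : ∀ k : ℕ, Continuous fun x : ℝ => a k * ((x : ℂ) ^ 2) ^ k := fun k => by fun_prop
  have h := intervalIntegral.hasSum_intervalIntegral_of_summable_norm (a := (0 : ℝ)) (b := 1 / 2)
    (f := fun k => (⟨_, hc k⟩ : C(ℝ, ℂ))) (by
      refine .of_nonneg_of_le (fun k => norm_nonneg _) (fun k => ?_)
        -- On `[0, 1/2]` the variable `x ^ 2` is at most `1/4`.
        (ha (1 / 4) (by norm_num) (by norm_num))
      refine (ContinuousMap.norm_le _ (by positivity)).mpr fun x => ?_
      have hx := x.2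
      simp only [Set.uIcc_of_le (show (0 : ℝ) ≤ 1 / 2 by norm_num)] at hx
      have h2 : |(x : ℝ)| ^ 2 ≤ 1 / 4 := by
        rw [sq_abs]; nlinarith [hx.1, hx.2]
      simp only [TopologicalSpace.Compacts.coe_mk, ContinuousMap.restrict_apply,
        ContinuousMap.coe_mk, norm_mul, norm_pow, Complex.norm_real, Real.norm_eq_abs]
      gcongr)
  have e : ∀ k : ℕ, (∫ x in (0 : ℝ)..1 / 2, (⟨_, hc k⟩ : C(ℝ, ℂ)) x) =
      a k * ((1 / 2) ^ (2 * k + 1) / (2 * k + 1)) := by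
    intro k
    simp only [ContinuousMap.coe_mk]
    rw [intervalIntegral.integral_const_mul]
    congr 1
    have : ∀ x : ℝ, ((x : ℂ) ^ 2) ^ k = ((x ^ (2 * k) : ℝ) : ℂ) := fun x => by
      rw [← pow_mul]; push_cast; rfl
    simp_rw [this]
    rw [intervalIntegral.integral_ofReal, integral_pow]
    push_cast
    simp
  simp only [e] at h
  exact h

/-! ### Integrals of the regular part over the half period. -/

theorem toReal_half_neg : -((1 / 2 : ℝ) : UnitAddCircle) = ((1 / 2 : ℝ) : UnitAddCircle) := by
  rw [← AddCircle.coe_neg, ← sub_eq_zero, ← AddCircle.coe_sub]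
  norm_num

/-- This is `∂ₓ ζ(s - 1, x) = (1 - s) * ζ(s, x)` read on coefficients. The `2` at `k = 0` is `(1 -
s)` times the polar constant `2 / (s - 1)`, which `signedCoeff 0 s` leaves out. -/
theorem signedCoeff_one_sub_one (s : ℂ) (k : ℕ) :
    signedCoeff 1 (s - 1) k = (1 - s) * signedCoeff 0 s k / (2 * k + 1) -
      if k = 0 then 2 else 0 := by
  cases k with
  | zero =>
    simp [signedCoeff, hurwitzCoeff, riemannZeta₁]
    ring
  | succ k =>
    have h1 : (2 * ((k : ℂ) + 1) + 1) ≠ 0 := by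
      have : ((2 * (k + 1) + 1 : ℕ) : ℂ) ≠ 0 := Nat.cast_ne_zero.mpr (by omega)
      push_cast at this
      exact this
    have h2 : (2 * (k : ℂ) + 1 + 1) ≠ 0 := by
      have : ((2 * k + 1 + 1 : ℕ) : ℂ) ≠ 0 := Nat.cast_ne_zero.mpr (by omega)
      push_cast at this
      exact this
    have h3 : Ring.choose (-(s - 1)) (2 * k + 1 + 1) * (2 * k + 1 + 1) =
        (1 - s) * Ring.choose (-s) (2 * k + 1) := by
      have h4 := Ring.choose_smul_choose (-(s - 1)) (n := 2 * k + 1 + 1) (k := 1) (by omega)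
      rw [Nat.choose_one_right, Ring.choose_one_right, nsmul_eq_mul] at h4
      have h5 : -(s - 1) - ((1 : ℕ) : ℂ) = -s := by push_cast; ring
      rw [h5, Nat.add_sub_cancel] at h4
      push_cast at h4
      linear_combination h4
    have h6 : Ring.choose (-(s - 1)) (2 * k + 1 + 1) =
        (1 - s) * Ring.choose (-s) (2 * k + 1) / (2 * k + 1 + 1) := by
      rw [eq_div_iff h2, h3]
    rw [signedCoeff, signedCoeff, show 2 * (k + 1) + 1 = (2 * k + 1 + 1) + 1 by ring,
      show 2 * (k + 1) + 0 = (2 * k + 1) + 1 by ring, hurwitzCoeff, hurwitzCoeff, h6]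
    push_cast
    rw [show s - 1 + (2 * (k : ℂ) + 2) + 1 = s + (2 * k + 1) + 1 by ring]
    have h7 : 2 * (k : ℂ) + 2 + 1 ≠ 0 := by
      rw [show 2 * (k : ℂ) + 2 + 1 = 2 * ((k : ℂ) + 1) + 1 by ring]; exact h1
    simp only [sub_zero]
    field_simp

/-- Up to the factor `1 - s`, an antiderivative of the even function at `s` is the odd function at
`s - 1`, which vanishes at `1/2` because `1/2 = -1/2` on the circle. -/
theorem one_sub_mul_integral_powSum (s : ℂ) :
    (1 - s) * ∫ x in (0 : ℝ)..1 / 2, powSum (signedCoeff 0 s) ((x : ℂ) ^ 2) =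
      1 - 2 ^ (s - 1) := by
  have h1 := two_mul_hurwitzZetaOdd (s - 1) (x := 1 / 2) (by norm_num) (by norm_num)
  have h2 : hurwitzZetaOdd ((1 / 2 : ℝ) : UnitAddCircle) (s - 1) = 0 := by
    have := hurwitzZetaOdd_neg ((1 / 2 : ℝ) : UnitAddCircle) (s - 1)
    rw [toReal_half_neg] at this
    linear_combination this / 2
  rw [h2, mul_zero] at h1
  have h3 := ((radiusGeOne_signedCoeff 0 s).hasSum_integral.mul_left (1 - s)).sub
    (hasSum_ite_eq 0 1)
  have h4 : (fun k : ℕ => (1 - s) * (signedCoeff 0 s k * ((1 / 2) ^ (2 * k + 1) / (2 * k + 1))) -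
      if k = 0 then 1 else 0) =
      fun k => 1 / 2 * (signedCoeff 1 (s - 1) k * (((1 / 2 : ℝ) : ℂ) ^ 2) ^ k) := by
    funext k
    rw [signedCoeff_one_sub_one, ← pow_mul]
    push_cast
    split_ifs with hk
    · subst hk; simp; ring
    · rw [pow_succ]; ring
  rw [h4] at h3
  have h5 := ((radiusGeOne_signedCoeff 1 (s - 1)).summable
    (norm_ofReal_sq_lt_one (x := 1 / 2) (by rw [abs_of_pos] <;> norm_num))).hasSum.mul_left (1 / 2)
  have h6 := h3.unique h5
  rw [← powSum] at h6
  have h7 : (((1 / 2 : ℝ) : ℂ)) ^ (-(s - 1)) = 2 ^ (s - 1) := by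
    rw [one_div, Complex.ofReal_inv, Complex.inv_cpow _ _ (by
      rw [Complex.arg_ofReal_of_nonneg (by norm_num)]; exact Real.pi_pos.ne), Complex.cpow_neg,
      inv_inv]
    norm_num
  rw [h7] at h1
  push_cast at h1 h6
  linear_combination h6 - h1

/-- The previous identity, divided by `1 - s`, presents the integral as the difference quotient of
`2 ^ (s - 1)` at `s = 1`; let `s → 1`. -/
theorem integral_powSum_signedCoeff_one :
    ∫ x in (0 : ℝ)..1 / 2, powSum (signedCoeff 0 1) ((x : ℂ) ^ 2) = (Real.log 2 : ℝ) := by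
  set K : ℂ → ℂ := fun s => ∫ x in (0 : ℝ)..1 / 2, powSum (signedCoeff 0 s) ((x : ℂ) ^ 2) with hK
  have hc : ContinuousAt K 1 := by
    obtain ⟨u, hu, hub⟩ := exists_summable_signedCoeff_bound 0 2 (r := 1 / 4) (by norm_num)
      (by norm_num)
    have h1 : K = fun s => ∑' k : ℕ, signedCoeff 0 s k * ((1 / 2) ^ (2 * k + 1) / (2 * k + 1)) :=
      funext fun s => (radiusGeOne_signedCoeff 0 s).hasSum_integral.tsum_eq.symm
    rw [h1]
    refine (continuousOn_tsum (s := Metric.ball 0 2) (fun k => ?_) hu fun k s hs => ?_).continuousAt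
      (Metric.isOpen_ball.mem_nhds (by simp))
    · have := (differentiable_hurwitzCoeff (2 * k + 0)).continuous
      unfold signedCoeff
      fun_prop
    · refine le_trans ?_ (hub s (mem_ball_zero_iff.mp hs).le k)
      rw [norm_mul]
      gcongr
      have h2 : ‖(2 * (k : ℂ) + 1)‖ = 2 * k + 1 := by
        have : (2 * (k : ℂ) + 1) = ((2 * k + 1 : ℕ) : ℂ) := by push_cast; ring
        rw [this, Complex.norm_natCast]; push_cast; ring
      rw [norm_div, h2, norm_pow, div_le_iff₀ (by positivity), pow_succ, pow_mul]
      norm_num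
      have h3 : (0 : ℝ) < (1 / 4) ^ k := by positivity
      nlinarith [k.cast_nonneg (α := ℝ)]
  have hd : HasDerivAt (fun s : ℂ => (2 : ℂ) ^ (s - 1)) (Complex.log 2) 1 := by
    have := (((hasDerivAt_id (1 : ℂ)).sub_const 1).const_cpow (c := 2) (Or.inl two_ne_zero))
    simpa using this
  have ht := hd.tendsto_slope
  have h3 : Filter.Tendsto K (nhdsWithin 1 {1}ᶜ) (nhds (Complex.log 2)) := by
    refine ht.congr' ?_
    filter_upwards [self_mem_nhdsWithin] with s hs
    have hs1 : s - 1 ≠ 0 := sub_ne_zero.mpr hs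
    have := one_sub_mul_integral_powSum s
    rw [slope_def_field, div_eq_iff hs1]
    simp only [sub_self, Complex.cpow_zero]
    rw [hK]
    linear_combination this
  have h4 := tendsto_nhds_unique (hc.tendsto.mono_left nhdsWithin_le_nhds) h3
  simp only [hK] at h4
  rw [h4, Complex.ofReal_log (by norm_num)]
  norm_num

/-! ### Riemann sums of smooth periodic functions. -/

/-- A `1/q`-periodic differentiable function with mean zero is bounded by `1/q` times its
derivative. -/
theorem norm_le_of_periodic_of_integral_eq_zero {T C : ℝ} (hT : 0 < T) {f f' : ℝ → ℂ}
    (hf : ∀ x, HasDerivAt f (f' x) x) (hper : Function.Periodic f T)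
    (hint : ∫ x in (0 : ℝ)..T, f x = 0) (hC : ∀ x, ‖f' x‖ ≤ C) (t : ℝ) : ‖f t‖ ≤ T * C := by
  have hcont : Continuous f := continuous_iff_continuousAt.mpr fun x => (hf x).continuousAt
  have h1 : ∫ x in t..t + T, f x = 0 := by
    rw [hper.intervalIntegral_add_eq t 0, zero_add, hint]
  -- Mean zero makes `f t` the average of `f t - f x` over a period, which the mean value inequality
  -- controls.
  have h2 : ∫ x in t..t + T, (f t - f x) = T * f t := by
    rw [integral_sub (by simp) (hcont.intervalIntegrable _ _), h1]
    simp
  have hC0 : 0 ≤ C := (norm_nonneg _).trans (hC 0)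
  have h3 : ∀ x ∈ Set.uIoc t (t + T), ‖f t - f x‖ ≤ T * C := by
    intro x hx
    rw [Set.uIoc_of_le (by linarith)] at hx
    have := convex_univ.norm_image_sub_le_of_norm_hasDerivWithin_le (𝕜 := ℝ) (f := f) (f' := f')
      (fun y _ => (hf y).hasDerivWithinAt) (fun y _ => hC y) (Set.mem_univ x) (Set.mem_univ t)
    refine this.trans ?_
    rw [mul_comm, Real.norm_eq_abs, abs_sub_comm, abs_of_nonneg (by linarith [hx.1])]
    gcongr
    linarith [hx.2]
  have h4 := norm_integral_le_of_norm_le_const h3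
  rw [h2, norm_mul, Complex.norm_real, Real.norm_of_nonneg hT.le, add_sub_cancel_left,
    abs_of_pos hT, mul_comm] at h4
  exact le_of_mul_le_mul_right h4 hT

/-- The derivative of a periodic function is periodic with mean zero, so the first-order bound
iterates and each derivative gains a factor `T`. -/
theorem norm_le_of_periodic_of_contDiff {T C : ℝ} (hT : 0 < T) (k : ℕ) {f : ℝ → ℂ}
    (hf : ContDiff ℝ k f) (hper : Function.Periodic f T) (hint : ∫ x in (0 : ℝ)..T, f x = 0)
    (hC : ∀ x, ‖iteratedDeriv k f x‖ ≤ C) (t : ℝ) : ‖f t‖ ≤ T ^ k * C := by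
  induction k generalizing f t with
  | zero => simpa using hC t
  | succ k ih =>
    rw [Nat.cast_succ] at hf
    have hd := (contDiff_succ_iff_deriv.mp hf).1
    have hd' : ContDiff ℝ k (deriv f) := (contDiff_succ_iff_deriv.mp hf).2.2
    have hper' : Function.Periodic (deriv f) T := fun x => by
      rw [← deriv_comp_add_const]
      congr 1
      funext y
      exact hper y
    have hint' : ∫ x in (0 : ℝ)..T, deriv f x = 0 := by
      rw [integral_eq_sub_of_hasDerivAt (fun x _ => (hd x).hasDerivAt)
        (hd'.continuous.intervalIntegrable _ _)]
      have := hper 0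
      rw [zero_add] at this
      rw [this, sub_self]
    have h := ih hd' hper' hint' fun x => by rw [← iteratedDeriv_succ']; exact hC x
    have := norm_le_of_periodic_of_integral_eq_zero hT (fun x => (hd x).hasDerivAt) hper hint h t
    rw [pow_succ', mul_assoc]
    exact this

theorem iteratedDeriv_sum_translates {u : ℝ → ℂ} {k : ℕ} (hu : ContDiff ℝ k u) (q : ℕ) (x : ℝ) :
    iteratedDeriv k (fun t => ∑ a ∈ Finset.range q, u (t + a / q)) x =
      ∑ a ∈ Finset.range q, iteratedDeriv k u (x + a / q) := by
  rw [iteratedDeriv_fun_sum fun i _ => by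
    exact (hu.comp (contDiff_id.add contDiff_const)).contDiffAt]
  simp_rw [iteratedDeriv_comp_add_const]

/-- Equally spaced quadrature of a smooth periodic function converges to arbitrary order. -/
theorem exists_norm_sum_range_sub_integral_le {u : ℝ → ℂ} {k : ℕ} (hu : ContDiff ℝ k u)
    (hper : Function.Periodic u 1) :
    ∃ C : ℝ, ∀ q : ℕ, 0 < q →
      ‖∑ a ∈ Finset.range q, u (a / q) - q * ∫ x in (0 : ℝ)..1, u x‖ ≤ C * q / (q : ℝ) ^ k := by
  have hperk : Function.Periodic (iteratedDeriv k u) 1 := fun x => by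
    have h := congrFun (iteratedDeriv_comp_add_const k u 1) x
    rw [funext hper] at h
    exact h.symm
  obtain ⟨B, hB⟩ : ∃ B, ∀ x, ‖iteratedDeriv k u x‖ ≤ B := by
    obtain ⟨B, hB⟩ := (isCompact_Icc (a := (0 : ℝ)) (b := 1)).exists_bound_of_continuousOn
      (hu.continuous_iteratedDeriv k le_rfl).continuousOn
    refine ⟨B, fun x => ?_⟩
    obtain ⟨y, hy, hxy⟩ := hperk.exists_mem_Ico₀ one_pos x
    rw [hxy]
    exact hB y ⟨hy.1, hy.2.le⟩
  have hfin : ∀ q : ℕ, 0 < q → ∀ v : ℝ → ℂ, ContDiff ℝ k v → Function.Periodic v 1 →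
      (∀ x, ‖iteratedDeriv k v x‖ ≤ B + B) → ∫ x in (0 : ℝ)..1, v x = 0 →
      ‖∑ a ∈ Finset.range q, v (a / q)‖ ≤ (B + B) * q / (q : ℝ) ^ k := by
    intro q hq v hv hvper hvB hvint
    have hq0 : (0 : ℝ) < q := by exact_mod_cast hq
    -- Summing the translates by `a / q` gives a function of period `1 / q` whose value at `0` is
    -- the Riemann sum; with `T = 1 / q` each derivative gains `1 / q`.
    set Φ : ℝ → ℂ := fun t => ∑ a ∈ Finset.range q, v (t + a / q) with hΦ
    have hΦc : ContDiff ℝ k Φ := by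
      refine ContDiff.sum fun a _ => ?_
      exact hv.comp (contDiff_id.add contDiff_const)
    have hΦper : Function.Periodic Φ (1 / q) := by
      intro t
      rw [hΦ]
      dsimp only
      have h1 : ∀ a : ℕ, v (t + 1 / q + a / q) = v (t + (a + 1 : ℕ) / q) := fun a => by
        congr 1; push_cast; ring
      simp_rw [h1]
      have h2 := Finset.sum_range_succ' (fun a : ℕ => v (t + a / q)) q
      rw [Finset.sum_range_succ] at h2
      have h3 : v (t + (q : ℝ) / q) = v (t + ((0 : ℕ) : ℝ) / q) := by
        rw [div_self hq0.ne', hvper]; simp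
      rw [h3] at h2
      exact (add_right_cancel h2).symm
    have hΦint : ∫ x in (0 : ℝ)..1 / q, Φ x = 0 := by
      rw [hΦ, intervalIntegral.integral_finsetSum fun a _ => by
        exact (hv.continuous.comp (by fun_prop)).intervalIntegrable _ _]
      simp_rw [intervalIntegral.integral_comp_add_right]
      have h1 := sum_integral_adjacent_intervals (f := v) (μ := volume)
        (a := fun a : ℕ => (a : ℝ) / q) (n := q) fun a _ => hv.continuous.intervalIntegrable _ _
      simp only [Nat.cast_zero, zero_div, div_self hq0.ne'] at h1
      rw [hvint] at h1
      rw [← h1]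
      refine Finset.sum_congr rfl fun a _ => ?_
      congr 1
      · ring
      · push_cast; ring
    have h := norm_le_of_periodic_of_contDiff (by positivity) k hΦc hΦper hΦint
      (C := q * (B + B)) (fun x => by
        rw [hΦ, iteratedDeriv_sum_translates hv]
        refine (norm_sum_le _ _).trans ?_
        refine (Finset.sum_le_card_nsmul _ _ (B + B) fun a _ => hvB _).trans ?_
        rw [Finset.card_range, nsmul_eq_mul]) 0
    rw [hΦ] at h
    simp only [zero_add] at h
    refine h.trans (le_of_eq ?_)
    rw [one_div, inv_pow]
    ring
  have hB0 : 0 ≤ B := (norm_nonneg _).trans (hB 0)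
  set m : ℂ := ∫ x in (0 : ℝ)..1, u x with hm
  -- Subtracting the mean leaves `iteratedDeriv k` unchanged only when `k > 0`; for `k = 0` the
  -- trivial bound is enough.
  rcases Nat.eq_zero_or_pos k with rfl | hk
  · refine ⟨B + ‖m‖, fun q hq => ?_⟩
    have hBu : ∀ x, ‖u x‖ ≤ B := fun x => by simpa using hB x
    rw [pow_zero, div_one]
    refine (norm_sub_le _ _).trans ?_
    have h1 : ‖∑ a ∈ Finset.range q, u (a / q)‖ ≤ q * B := by
      refine (norm_sum_le _ _).trans ?_
      refine (Finset.sum_le_card_nsmul _ _ B fun a _ => hBu _).trans ?_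
      simp
    rw [norm_mul, Complex.norm_natCast]
    linarith
  · refine ⟨B + B, fun q hq => ?_⟩
    have hv : ContDiff ℝ k fun x => u x - m := hu.sub contDiff_const
    have h := hfin q hq (fun x => u x - m) hv (fun x => by simp [hper x]) (fun x => ?_) ?_
    · simpa using h
    · rw [iteratedDeriv_fun_sub hu.contDiffAt contDiffAt_const, iteratedDeriv_const,
        if_neg hk.ne', sub_zero]
      linarith [hB x]
    · rw [integral_sub (hu.continuous.intervalIntegrable _ _) (by simp)]
      simp [hm]

/-! ### Finite smoothness of `x ^ m * |x| ^ β`. -/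

/-- At the origin the function is `x` times something tending to `0`. The derivative has the same
shape with `m` lowered by one, so induction yields class `C ^ m`. -/
theorem hasDerivAt_pow_mul_abs_rpow {β : ℝ} (hβ : 0 < β) (m : ℕ) (x : ℝ) :
    HasDerivAt (fun x : ℝ => x ^ (m + 1) * |x| ^ β) ((m + 1 + β) * (x ^ m * |x| ^ β)) x := by
  rcases lt_trichotomy x 0 with hx | rfl | hx
  · have h1 : HasDerivAt (fun x : ℝ => x ^ (m + 1) * (-x) ^ β) ((m + 1 + β) * (x ^ m * |x| ^ β)) x := by
      have h := (hasDerivAt_pow (m + 1) x).mul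
        ((hasDerivAt_neg x).rpow_const (p := β) (Or.inl (by linarith)))
      convert! h using 1
      have hx0 : x ≠ 0 := hx.ne
      rw [abs_of_neg hx, Real.rpow_sub_one (by linarith)]
      field_simp
      push_cast
      rw [pow_succ]
      ring
    refine h1.congr_of_eventuallyEq ?_
    filter_upwards [eventually_lt_nhds hx] with y hy
    rw [abs_of_neg hy]
  · rw [hasDerivAt_iff_isLittleO_nhds_zero]
    simp only [zero_add, abs_zero, Real.zero_rpow hβ.ne', mul_zero, sub_zero, smul_zero]
    have h1 : (fun h : ℝ => h ^ m * |h| ^ β) =o[nhds 0] fun _ => (1 : ℝ) := by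
      rw [Asymptotics.isLittleO_one_iff]
      have hc : Continuous fun h : ℝ => h ^ m * |h| ^ β :=
        (continuous_pow m).mul (continuous_abs.rpow_const fun _ => Or.inr hβ.le)
      simpa [Real.zero_rpow hβ.ne'] using hc.tendsto 0
    have h2 := (Asymptotics.isBigO_refl (fun h : ℝ => h) (nhds 0)).mul_isLittleO h1
    refine (h2.congr (fun h => ?_) fun h => mul_one h)
    ring
  · have h1 : HasDerivAt (fun x : ℝ => x ^ (m + 1) * x ^ β) ((m + 1 + β) * (x ^ m * |x| ^ β)) x := by
      have h := (hasDerivAt_pow (m + 1) x).mul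
        ((hasDerivAt_id x).rpow_const (p := β) (Or.inl hx.ne'))
      convert! h using 1
      simp only [id]
      rw [abs_of_pos hx, Real.rpow_sub_one hx.ne']
      field_simp
      push_cast
      rw [pow_succ]
      field_simp
    refine h1.congr_of_eventuallyEq ?_
    filter_upwards [eventually_gt_nhds hx] with y hy
    rw [abs_of_pos hy]

theorem contDiff_pow_mul_abs_rpow {β : ℝ} (hβ : 0 < β) (m : ℕ) :
    ContDiff ℝ m fun x : ℝ => x ^ m * |x| ^ β := by
  induction m with
  | zero =>
    rw [Nat.cast_zero, contDiff_zero]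
    exact (continuous_pow 0).mul (continuous_abs.rpow_const fun _ => Or.inr hβ.le)
  | succ m ih =>
    rw [Nat.cast_succ, contDiff_succ_iff_deriv]
    refine ⟨fun x => (hasDerivAt_pow_mul_abs_rpow hβ m x).differentiableAt, by simp, ?_⟩
    have : deriv (fun x : ℝ => x ^ (m + 1) * |x| ^ β) =
        fun x => (m + 1 + β) * (x ^ m * |x| ^ β) :=
      funext fun x => (hasDerivAt_pow_mul_abs_rpow hβ m x).deriv
    rw [this]
    exact contDiff_const.mul ih

/-! ### Exact sums over the fractions `n / q`. -/

theorem ZMod.sum_ne_zero_toAddCircle {q : ℕ} [NeZero q] (f : UnitAddCircle → ℂ) :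
    ∑ j : ZMod q with j ≠ 0, f (ZMod.toAddCircle j) =
      ∑ a ∈ Finset.Ico 1 q, f (((a : ℝ) / q : ℝ) : UnitAddCircle) := by
  refine Finset.sum_nbij' (fun j => j.val) (fun a => (a : ZMod q)) ?_ ?_ ?_ ?_ ?_
  · intro j hj
    simp only [Finset.mem_filter, Finset.mem_univ, true_and] at hj
    rw [Finset.mem_Ico]
    exact ⟨Nat.one_le_iff_ne_zero.mpr (by rwa [ne_eq, ZMod.val_eq_zero]), ZMod.val_lt j⟩
  · intro a ha
    rw [Finset.mem_Ico] at ha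
    simp only [Finset.mem_filter, Finset.mem_univ, true_and]
    rw [← ZMod.val_ne_zero, ZMod.val_natCast_of_lt ha.2]
    omega
  · intro j _
    simp
  · intro a ha
    rw [Finset.mem_Ico] at ha
    exact ZMod.val_natCast_of_lt ha.2
  · intro j _
    rw [ZMod.toAddCircle_apply]

/-- Compute `L(s, χ₀)` twice: by its Euler factor it is `(1 - q ^ (-s)) * ζ(s)`, and as an even
function on `ZMod q` it is `q ^ (-s)` times the sum of the Hurwitz values. -/
theorem sum_hurwitzZetaEven {q : ℕ} (hq : q.Prime) {s : ℂ} (hs : s ≠ 1) :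
    ∑ a ∈ Finset.Ico 1 q, 2 * hurwitzZetaEven (((a : ℝ) / q : ℝ) : UnitAddCircle) s =
      2 * ((q : ℂ) ^ s - 1) * riemannZeta s := by
  have : NeZero q := ⟨hq.ne_zero⟩
  have : Fact q.Prime := ⟨hq⟩
  have hq0 : (q : ℂ) ≠ 0 := by exact_mod_cast hq.ne_zero
  have h1 := DirichletCharacter.LFunctionTrivChar_eq_mul_riemannZeta (N := q) hs
  rw [hq.primeFactors, Finset.prod_singleton, DirichletCharacter.LFunctionTrivChar,
    DirichletCharacter.LFunction, ZMod.LFunction_def_even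
      (show (1 : DirichletCharacter ℂ q).Even from MulChar.one_apply isUnit_one.neg).to_fun] at h1
  have h2 : ∑ j : ZMod q, (1 : DirichletCharacter ℂ q) j * hurwitzZetaEven (ZMod.toAddCircle j) s =
      ∑ j : ZMod q with j ≠ 0, hurwitzZetaEven (ZMod.toAddCircle j) s := by
    rw [Finset.sum_filter]
    refine Finset.sum_congr rfl fun j _ => ?_
    split_ifs with hj
    · rw [MulChar.one_apply (IsUnit.mk0 j hj), one_mul]
    · rw [not_not.mp hj, MulChar.map_zero, zero_mul]
  rw [h2, ZMod.sum_ne_zero_toAddCircle fun x => hurwitzZetaEven x s] at h1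
  rw [← Finset.mul_sum]
  have h3 : (q : ℂ) ^ s * (q : ℂ) ^ (-s) = 1 := by
    rw [← Complex.cpow_add _ _ hq0, add_neg_cancel, Complex.cpow_zero]
  linear_combination 2 * (q : ℂ) ^ s * h1 - (2 * (∑ a ∈ Finset.Ico 1 q,
    hurwitzZetaEven (((a : ℝ) / q : ℝ) : UnitAddCircle) s) + 2 * riemannZeta s) * h3

/-- The constant term of `2 * hurwitzZetaEven x s` at `s = 1`, that is, `-ψ(x) - ψ(1 - x)` for
`0 < x < 1`. -/
noncomputable def evenDigamma (x : ℝ) : ℂ :=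
  limUnder (𝓝[≠] 1) fun s : ℂ => 2 * hurwitzZetaEven x s - 2 / (s - 1)

theorem evenDigamma_periodic : Function.Periodic evenDigamma 1 := fun x => by
  simp [evenDigamma]

theorem tendsto_evenDigamma_aux {x : ℝ} (hx : x ≠ 0) (hx1 : |x| < 1) :
    Tendsto (fun s : ℂ => 2 * hurwitzZetaEven x s - 2 / (s - 1)) (𝓝[≠] 1)
      (𝓝 (((|x| : ℝ) : ℂ)⁻¹ + powSum (signedCoeff 0 1) (x ^ 2))) := by
  have hx0 : ((|x| : ℝ) : ℂ) ≠ 0 := by exact_mod_cast (abs_pos.mpr hx).ne'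
  have h1 : ContinuousAt (fun s : ℂ => ((|x| : ℝ) : ℂ) ^ (-s) + powSum (signedCoeff 0 s) (x ^ 2))
      1 := by
    refine ContinuousAt.add ?_
      (differentiable_powSum_signedCoeff 0 (norm_ofReal_sq_lt_one hx1)).continuous.continuousAt
    exact ContinuousAt.const_cpow (by fun_prop) (Or.inl hx0)
  have h2 := h1.tendsto.mono_left (nhdsWithin_le_nhds (s := {1}ᶜ))
  rw [Complex.cpow_neg_one] at h2
  refine h2.congr' ?_
  filter_upwards [self_mem_nhdsWithin] with s hs
  rw [two_mul_hurwitzZetaEven hs hx hx1]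
  ring

theorem evenDigamma_eq {x : ℝ} (hx : x ≠ 0) (hx1 : |x| < 1) :
    evenDigamma x = ((|x| : ℝ) : ℂ)⁻¹ + powSum (signedCoeff 0 1) (x ^ 2) :=
  (tendsto_evenDigamma_aux hx hx1).limUnder_eq

/-- Take `s → 1` in the exact sum after removing `2 / (s - 1)` from each of the `q - 1` terms: the
polar part of `ζ` yields the derivative of `q ^ s`, the rest yields `γ`. -/
theorem sum_evenDigamma {q : ℕ} (hq : q.Prime) :
    ∑ a ∈ Finset.Ico 1 q, evenDigamma (a / q) =
      2 * q * (Real.log q : ℂ) + 2 * (q - 1) * Real.eulerMascheroniConstant := by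
  have hq0 : (q : ℂ) ≠ 0 := by exact_mod_cast hq.ne_zero
  have hqpos : (0 : ℝ) < q := by exact_mod_cast hq.pos
  have h1 : Tendsto (fun s : ℂ => ∑ a ∈ Finset.Ico 1 q,
      (2 * hurwitzZetaEven (((a : ℝ) / q : ℝ) : UnitAddCircle) s - 2 / (s - 1))) (𝓝[≠] 1)
      (𝓝 (∑ a ∈ Finset.Ico 1 q, evenDigamma (a / q))) := by
    refine tendsto_finsetSum _ fun a ha => ?_
    rw [Finset.mem_Ico] at ha
    have ha0 : (0 : ℝ) < a := by exact_mod_cast ha.1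
    have ha1 : (a : ℝ) / q < 1 := (div_lt_one hqpos).mpr (by exact_mod_cast ha.2)
    have hx : (a : ℝ) / q ≠ 0 := by positivity
    have hx1 : |(a : ℝ) / q| < 1 := by rwa [abs_of_pos (by positivity)]
    rw [evenDigamma_eq hx hx1]
    exact tendsto_evenDigamma_aux hx hx1
  have hd : HasDerivAt (fun s : ℂ => (q : ℂ) ^ s) (q * Complex.log q) 1 := by
    have := ((hasDerivAt_id (1 : ℂ)).const_cpow (c := (q : ℂ)) (Or.inl hq0))
    simpa using this
  have hζ : Tendsto riemannZeta₀ (𝓝[≠] 1) (𝓝 Real.eulerMascheroniConstant) := by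
    have := differentiable_riemannZeta₀.continuous.tendsto 1
    rw [riemannZeta₀_one] at this
    exact this.mono_left nhdsWithin_le_nhds
  have h2 : Tendsto (fun s : ℂ => 2 * slope (fun s : ℂ => (q : ℂ) ^ s) 1 s +
      2 * ((q : ℂ) ^ s - 1) * riemannZeta₀ s) (𝓝[≠] 1) (𝓝 (2 * (q * Complex.log q) +
        2 * (q - 1) * Real.eulerMascheroniConstant)) := by
    refine (hd.tendsto_slope.const_mul 2).add (Tendsto.mul (Tendsto.const_mul _ ?_) hζ)
    have := hd.continuousAt.tendsto.mono_left (nhdsWithin_le_nhds (s := {1}ᶜ))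
    rw [Complex.cpow_one] at this
    exact this.sub_const 1
  have h3 := tendsto_nhds_unique h1 (h2.congr' ?_)
  · rw [h3, ← Complex.natCast_log]
    ring
  · filter_upwards [self_mem_nhdsWithin] with s hs
    have hs1 : s - 1 ≠ 0 := sub_ne_zero.mpr hs
    rw [Finset.sum_sub_distrib, sum_hurwitzZetaEven hq hs, riemannZeta_eq_inv_sub_add hs,
      slope_def_field]
    simp only [Finset.sum_const, Nat.card_Ico, nsmul_eq_mul, Complex.cpow_one]
    rw [Nat.cast_sub hq.one_lt.le]
    field_simp
    push_cast
    ring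

/-! ### Riemann sums of periodic functions with algebraic singularities. -/

theorem RadiusGeOne.shift {a : ℕ → ℂ} (ha : RadiusGeOne a) (m : ℕ) :
    RadiusGeOne fun k => a (m + k) := by
  intro r hr hr1
  rcases hr.eq_or_lt with rfl | hr0
  · exact summable_of_ne_finset_zero (s := {0}) fun k hk => by
      rw [zero_pow (by simpa using hk), mul_zero]
  have h := ((ha r hr hr1).comp_injective (add_right_injective m)).mul_left (r ^ m)⁻¹
  refine h.congr fun k => ?_
  simp only [Function.comp_apply, pow_add]
  field_simp

theorem powSum_eq_sum_add {a : ℕ → ℂ} (ha : RadiusGeOne a) {y : ℂ} (hy : ‖y‖ < 1) (m : ℕ) :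
    powSum a y = ∑ j ∈ Finset.range m, a j * y ^ j + y ^ m * powSum (fun k => a (m + k)) y := by
  rw [powSum, ← (ha.summable hy).sum_add_tsum_nat_add m, powSum, ← tsum_mul_left]
  congr 1
  refine tsum_congr fun k => ?_
  rw [pow_add, add_comm k m]
  ring

theorem ofReal_abs_cpow_add_two_mul {x : ℝ} (hx : x ≠ 0) (s : ℂ) (j : ℕ) :
    ((|x| : ℝ) : ℂ) ^ (s + 2 * j) = ((|x| : ℝ) : ℂ) ^ s * ((x : ℂ) ^ 2) ^ j := by
  have hx0 : ((|x| : ℝ) : ℂ) ≠ 0 := by exact_mod_cast (abs_pos.mpr hx).ne'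
  have h : (2 * (j : ℂ)) = ((2 * j : ℕ) : ℂ) := by push_cast; ring
  rw [Complex.cpow_add _ _ hx0, h, Complex.cpow_natCast, pow_mul, ← Complex.ofReal_pow, sq_abs,
    Complex.ofReal_pow]

/-- The integrand is `2 * hurwitzZetaEven x s`. Since its integral vanishes, the subtracted
functions do not affect the coefficient of `q`. -/
theorem integral_cpow_add_powSum {s : ℂ} (hs : s.re < 1) :
    ∫ x in (0 : ℝ)..1 / 2, ((x : ℂ) ^ (-s) + (2 / (s - 1) + powSum (signedCoeff 0 s) ((x : ℂ) ^ 2))) =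
      0 := by
  have hs1 : 1 - s ≠ 0 := by
    intro h
    have := congrArg Complex.re h
    simp at this
    linarith
  have hs2 : s - 1 ≠ 0 := by rw [← neg_ne_zero, neg_sub]; exact hs1
  have hre : -1 < (-s).re := by simpa using hs
  have h1 := (radiusGeOne_signedCoeff 0 s).intervalIntegrable
  rw [integral_add (intervalIntegrable_cpow' hre)
      (intervalIntegrable_const.add h1), integral_add (by simp) h1,
    integral_cpow (Or.inl hre), intervalIntegral.integral_const]
  have h2 := one_sub_mul_integral_powSum s
  have h3 : -s + 1 = 1 - s := by ring
  rw [h3, Complex.ofReal_zero, Complex.zero_cpow hs1]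
  have h4 : (((1 / 2 : ℝ) : ℂ)) ^ (1 - s) = 2 ^ (s - 1) := by
    rw [one_div, Complex.ofReal_inv, Complex.inv_cpow _ _ (by
      rw [Complex.arg_ofReal_of_nonneg (by norm_num)]; exact Real.pi_pos.ne), ← Complex.cpow_neg]
    norm_num
  rw [h4]
  refine mul_left_cancel₀ hs1 ?_
  rw [mul_add, mul_add, h2]
  simp only [Complex.real_smul]
  push_cast
  have h5 : (1 - s) / (s - 1) = -1 := by rw [div_eq_iff hs2]; ring
  have h6 : (1 - s) * ((1 / 2 - 0) * (2 / (s - 1))) = (1 - s) / (s - 1) := by ring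
  rw [h6, h5]
  field_simp
  ring

/-- The exponents in the expansion of sums of functions behaving like `x ^ (p - 1/2)` at `0`. -/
noncomputable def singularExponent (p j : ℕ) : ℂ := 1 / 2 - p - 2 * j

theorem singularExponent_re_lt (p j : ℕ) : (singularExponent p j).re < 1 := by
  simp only [singularExponent, Complex.sub_re, Complex.natCast_re, Complex.mul_re,
    Complex.re_ofNat, Complex.im_ofNat, zero_mul, sub_zero, Complex.div_ofNat_re, Complex.one_re]
  have : (0 : ℝ) ≤ p := p.cast_nonneg
  have : (0 : ℝ) ≤ j := j.cast_nonneg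
  linarith

theorem singularExponent_ne_one (p j : ℕ) : singularExponent p j ≠ 1 := fun h => by
  have := singularExponent_re_lt p j
  rw [h] at this
  simp at this

theorem neg_singularExponent (p j : ℕ) :
    -singularExponent p j = ((p : ℂ) - 1 / 2) + 2 * j := by
  rw [singularExponent]; ring

/-- The smooth remainder left after removing from a function with expansion
`|x|⁻¹ + |x| ^ (p - 1/2) * powSum a (x ^ 2) + powSum b (x ^ 2)` its leading singular terms. -/
noncomputable def smoothRemainder (p : ℕ) (a b : ℕ → ℂ) (M : ℕ) (x : ℝ) : ℂ :=
  ((x ^ (2 * M) * |x| ^ ((p : ℝ) + 3 / 2) : ℝ) : ℂ) * powSum (fun k => a (M + 1 + k)) (x ^ 2) +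
    powSum b (x ^ 2) - powSum (signedCoeff 0 1) (x ^ 2) -
    ∑ j ∈ Finset.range (M + 1), a j * (2 / (singularExponent p j - 1) +
      powSum (signedCoeff 0 (singularExponent p j)) (x ^ 2))

theorem smoothRemainder_neg (p : ℕ) (a b : ℕ → ℂ) (M : ℕ) (x : ℝ) :
    smoothRemainder p a b M (-x) = smoothRemainder p a b M x := by
  simp only [smoothRemainder, Complex.ofReal_neg, neg_sq, abs_neg, pow_mul]

/-- This is the contribution of the node `n = 0`, absent from the sums over `1 ≤ n < q`. It cancels
the `-2γ` and the `-2 * a j * ζ` parts of the exact sums, leaving only `b 0`. -/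
theorem smoothRemainder_zero (p : ℕ) (a b : ℕ → ℂ) (M : ℕ) :
    smoothRemainder p a b M 0 = b 0 - 2 * Real.eulerMascheroniConstant -
      ∑ j ∈ Finset.range (M + 1), 2 * a j * riemannZeta (singularExponent p j) := by
  have hp : (p : ℝ) + 3 / 2 ≠ 0 := by positivity
  rw [smoothRemainder]
  simp only [Complex.ofReal_zero, ne_eq, OfNat.ofNat_ne_zero, not_false_eq_true, zero_pow,
    powSum_zero, abs_zero, Real.zero_rpow hp, mul_zero, zero_mul, zero_add]
  congr 1
  · simp [signedCoeff, hurwitzCoeff]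
  · refine Finset.sum_congr rfl fun j _ => ?_
    rw [riemannZeta_eq_inv_sub_add (singularExponent_ne_one p j), signedCoeff]
    simp only [hurwitzCoeff]
    ring

/-- Dropping the first `M + 1` terms of the series for `a` leaves the factor `|x| ^ (p - 1/2 + 2 *
(M + 1)) = x ^ (2 * M) * |x| ^ (p + 3/2)`, which is smooth enough at `0`; the definition uses this
form because it makes sense there. -/
theorem smoothRemainder_eq {p : ℕ} {a : ℕ → ℂ} (ha : RadiusGeOne a) (b : ℕ → ℂ) (M : ℕ) {x : ℝ}
    (hx : x ≠ 0) (hx1 : |x| < 1) :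
    smoothRemainder p a b M x = ((|x| : ℝ) : ℂ) ^ ((p : ℂ) - 1 / 2) * powSum a (x ^ 2) +
      powSum b (x ^ 2) - powSum (signedCoeff 0 1) (x ^ 2) -
      ∑ j ∈ Finset.range (M + 1), a j * (((|x| : ℝ) : ℂ) ^ (-singularExponent p j) +
        (2 / (singularExponent p j - 1) +
          powSum (signedCoeff 0 (singularExponent p j)) (x ^ 2))) := by
  have hx0 : ((|x| : ℝ) : ℂ) ≠ 0 := by exact_mod_cast (abs_pos.mpr hx).ne'
  have h1 : ((x ^ (2 * M) * |x| ^ ((p : ℝ) + 3 / 2) : ℝ) : ℂ) =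
      ((|x| : ℝ) : ℂ) ^ ((p : ℂ) - 1 / 2) * ((x : ℂ) ^ 2) ^ (M + 1) := by
    rw [← ofReal_abs_cpow_add_two_mul hx]
    have : ((p : ℂ) - 1 / 2) + 2 * ((M + 1 : ℕ) : ℂ) = ((p : ℝ) + 3 / 2 : ℝ) + 2 * (M : ℂ) := by
      push_cast; ring
    rw [this, ofReal_abs_cpow_add_two_mul hx, ← Complex.ofReal_cpow (abs_nonneg x)]
    push_cast
    ring
  rw [smoothRemainder, powSum_eq_sum_add ha (norm_ofReal_sq_lt_one hx1) (M + 1), h1]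
  simp only [neg_singularExponent, ofReal_abs_cpow_add_two_mul hx, mul_add, Finset.sum_add_distrib,
    Finset.mul_sum]
  have h2 : ∀ j, ((|x| : ℝ) : ℂ) ^ ((p : ℂ) - 1 / 2) * (a j * ((x : ℂ) ^ 2) ^ j) =
      a j * (((|x| : ℝ) : ℂ) ^ ((p : ℂ) - 1 / 2) * ((x : ℂ) ^ 2) ^ j) := fun j => by ring
  simp only [h2]
  ring

theorem contDiffAt_smoothRemainder {p : ℕ} {a b : ℕ → ℂ} (ha : RadiusGeOne a) (hb : RadiusGeOne b)
    (M : ℕ) {x : ℝ} (hx : |x| < 1) : ContDiffAt ℝ (2 * M : ℕ) (smoothRemainder p a b M) x := by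
  unfold smoothRemainder
  refine ((ContDiffAt.add (ContDiffAt.mul ?_ ((ha.shift (M + 1)).contDiffAt hx))
    (hb.contDiffAt hx)).sub ((radiusGeOne_signedCoeff 0 1).contDiffAt hx)).sub ?_
  · exact (Complex.ofRealCLM.contDiff.comp
      (contDiff_pow_mul_abs_rpow (by positivity : (0 : ℝ) < (p : ℝ) + 3 / 2) (2 * M))).contDiffAt
  · refine ContDiffAt.sum fun j _ => ?_
    exact contDiffAt_const.mul
      (contDiffAt_const.add ((radiusGeOne_signedCoeff 0 _).contDiffAt hx))

theorem integral_smoothRemainder {p : ℕ} {a b : ℕ → ℂ} (ha : RadiusGeOne a) (hb : RadiusGeOne b)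
    (M : ℕ) :
    ∫ x in (0 : ℝ)..1 / 2, smoothRemainder p a b M x =
      (∫ x in (0 : ℝ)..1 / 2, ((x : ℂ) ^ ((p : ℂ) - 1 / 2) * powSum a ((x : ℂ) ^ 2) +
        powSum b ((x : ℂ) ^ 2))) - (Real.log 2 : ℝ) := by
  have hre : -1 < ((p : ℂ) - 1 / 2).re := by
    simp
    have : (0 : ℝ) ≤ p := p.cast_nonneg
    linarith
  have i1 : IntervalIntegrable (fun x : ℝ => (x : ℂ) ^ ((p : ℂ) - 1 / 2) * powSum a ((x : ℂ) ^ 2))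
      volume 0 (1 / 2) :=
    (intervalIntegrable_cpow' hre).mul_continuousOn (ha.continuousOn.mono uIcc_zero_half_subset)
  have i2 : ∀ j, IntervalIntegrable (fun x : ℝ => a j * ((x : ℂ) ^ (-singularExponent p j) +
        (2 / (singularExponent p j - 1) +
          powSum (signedCoeff 0 (singularExponent p j)) ((x : ℂ) ^ 2)))) volume 0 (1 / 2) := by
    intro j
    refine ((intervalIntegrable_cpow' ?_).add (intervalIntegrable_const.add
      (radiusGeOne_signedCoeff 0 _).intervalIntegrable)).const_mul _
    have := singularExponent_re_lt p j
    simp only [Complex.neg_re]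
    linarith
  have h1 : ∫ x in (0 : ℝ)..1 / 2, smoothRemainder p a b M x = ∫ x in (0 : ℝ)..1 / 2,
      (((x : ℂ) ^ ((p : ℂ) - 1 / 2) * powSum a ((x : ℂ) ^ 2) +
      powSum b ((x : ℂ) ^ 2)) - powSum (signedCoeff 0 1) ((x : ℂ) ^ 2) -
      ∑ j ∈ Finset.range (M + 1), a j * ((x : ℂ) ^ (-singularExponent p j) +
        (2 / (singularExponent p j - 1) +
          powSum (signedCoeff 0 (singularExponent p j)) ((x : ℂ) ^ 2)))) := by
    refine integral_congr_ae (ae_of_all _ fun x hx => ?_)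
    rw [Set.uIoc_of_le (by norm_num)] at hx
    rw [smoothRemainder_eq ha b M hx.1.ne' (by rw [abs_of_pos hx.1]; linarith [hx.2]),
      abs_of_pos hx.1]
  rw [h1, integral_sub ((i1.add hb.intervalIntegrable).sub
      (radiusGeOne_signedCoeff 0 1).intervalIntegrable) (by
        convert! IntervalIntegrable.sum (Finset.range (M + 1)) fun j _ => i2 j using 1
        funext x
        rw [Finset.sum_apply]),
    integral_sub (i1.add hb.intervalIntegrable) (radiusGeOne_signedCoeff 0 1).intervalIntegrable,
    integral_powSum_signedCoeff_one, integral_finsetSum fun j _ => i2 j]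
  simp only [intervalIntegral.integral_const_mul, integral_cpow_add_powSum (singularExponent_re_lt p _),
    mul_zero, Finset.sum_const_zero, sub_zero]

/-- The asymptotic expansion of `∑ h(n / q)` for a periodic function `h` with prescribed
singularities at the integers. -/
theorem exists_sum_sub_le_of_singular {h : ℝ → ℂ} (hper : Function.Periodic h 1) {p : ℕ}
    {a b : ℕ → ℂ} (ha : RadiusGeOne a) (hb : RadiusGeOne b)
    (hh : ∀ x : ℝ, x ≠ 0 → |x| < 1 → h x = ((|x| : ℝ) : ℂ)⁻¹ +
      (((|x| : ℝ) : ℂ) ^ ((p : ℂ) - 1 / 2) * powSum a (x ^ 2) + powSum b (x ^ 2))) (M : ℕ) :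
    ∃ C : ℝ, ∀ q : ℕ, q.Prime →
      ‖∑ n ∈ Finset.Ico 1 q, h (n / q) -
        (2 * q * (Real.log q + Real.eulerMascheroniConstant) +
          2 * q * ((∫ x in (0 : ℝ)..1 / 2, ((x : ℂ) ^ ((p : ℂ) - 1 / 2) * powSum a ((x : ℂ) ^ 2) +
            powSum b ((x : ℂ) ^ 2))) - (Real.log 2 : ℝ)) - b 0 +
          ∑ j ∈ Finset.range (M + 1), 2 * a j * riemannZeta (singularExponent p j) *
            (q : ℂ) ^ singularExponent p j)‖ ≤ C * q / (q : ℝ) ^ (2 * M) := by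
  classical
  set S : ℝ → ℂ := smoothRemainder p a b M with hS
  set E : ℕ → ℝ → ℂ := fun j x => 2 * hurwitzZetaEven x (singularExponent p j) with hE
  -- The values of the zeta functions at the integers are replaced by the limit `S 0`, which makes
  -- `R` smooth everywhere.
  set R : ℝ → ℂ := fun x => if Int.fract x = 0 then S 0 else
    h x - evenDigamma x - ∑ j ∈ Finset.range (M + 1), a j * E j x with hR
  have hEper : ∀ j, Function.Periodic (E j) 1 := fun j x => by simp [hE]
  have hRper : Function.Periodic R 1 := fun x => by
    simp only [hR, Int.fract_add_one, hper x, evenDigamma_periodic x, hEper _ x]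
  have hRS : ∀ x : ℝ, |x| < 1 → R x = S x := by
    intro x hx
    rcases eq_or_ne x 0 with rfl | hx0
    · simp [hR]
    · have hfr : Int.fract x ≠ 0 := by
        rw [ne_eq, Int.fract_eq_zero_iff]
        rintro ⟨n, rfl⟩
        have h1 : |n| < 1 := by exact_mod_cast hx
        rw [Int.abs_lt_one_iff] at h1
        exact hx0 (by simp [h1])
      simp only [hR, if_neg hfr, hS, hE]
      rw [smoothRemainder_eq ha b M hx0 hx, hh x hx0 hx, evenDigamma_eq hx0 hx]
      simp only [two_mul_hurwitzZetaEven (singularExponent_ne_one p _) hx0 hx, add_assoc]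
      ring
  have hRc : ContDiff ℝ (2 * M : ℕ) R := by
    rw [contDiff_iff_contDiffAt]
    intro x
    have h1 : ContDiffAt ℝ (2 * M : ℕ) S (x - round x) :=
      -- Every point lies within `1/2` of an integer, so the smoothness of `S` on `(-1, 1)`
      -- transfers to `R` by periodicity.
      contDiffAt_smoothRemainder ha hb M ((abs_sub_round x).trans_lt (by norm_num))
    have h2 : ContDiffAt ℝ (2 * M : ℕ) (fun y => S (y - round x)) x :=
      h1.comp x (contDiffAt_id.sub contDiffAt_const)
    refine h2.congr_of_eventuallyEq ?_
    have h3 : ∀ᶠ y : ℝ in 𝓝 x, |y - round x| < 1 := by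
      have hc : Continuous fun y : ℝ => |y - round x| := by fun_prop
      exact hc.continuousAt.eventually_lt_const ((abs_sub_round x).trans_lt (by norm_num))
    filter_upwards [h3] with y hy
    rw [← hRS _ hy]
    have := hRper.sub_int_mul_eq (x := y) (round x)
    rw [mul_one] at this
    exact this.symm
  -- Move the period to `[-1/2, 1/2]` and use that `S` is even.
  have hSint : ∫ x in (0 : ℝ)..1, R x = 2 * ∫ x in (0 : ℝ)..1 / 2, S x := by
    have hcont := hRc.continuous
    have h1 := hRper.intervalIntegral_add_eq 0 (-(1 / 2))
    rw [zero_add] at h1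
    rw [h1, show -(1 / 2 : ℝ) + 1 = 1 / 2 by norm_num,
      ← integral_add_adjacent_intervals (b := 0) (hcont.intervalIntegrable _ _)
        (hcont.intervalIntegrable _ _)]
    have h2 : ∫ x in (0 : ℝ)..1 / 2, R x = ∫ x in (0 : ℝ)..1 / 2, S x := by
      refine integral_congr fun x hx => hRS x ?_
      exact abs_lt.mpr (uIcc_zero_half_subset hx)
    have h3 : ∫ x in (-(1 / 2) : ℝ)..0, R x = ∫ x in (0 : ℝ)..1 / 2, S x := by
      have h4 := integral_comp_neg (f := R) (a := (0 : ℝ)) (b := 1 / 2)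
      rw [neg_zero] at h4
      rw [← h4]
      refine integral_congr fun x hx => ?_
      rw [hRS (-x) (by rw [abs_neg]; exact abs_lt.mpr (uIcc_zero_half_subset hx)), hS,
        smoothRemainder_neg]
    rw [h2, h3, two_mul]
  obtain ⟨C, hC⟩ := exists_norm_sum_range_sub_integral_le hRc hRper
  refine ⟨C, fun q hq => ?_⟩
  have hq0 : (0 : ℝ) < q := by exact_mod_cast hq.pos
  refine le_of_eq_of_le ?_ (hC q hq.pos)
  congr 1
  have e1 : ∑ n ∈ Finset.range q, R (n / q) = S 0 + (∑ n ∈ Finset.Ico 1 q, h (n / q) -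
      ∑ n ∈ Finset.Ico 1 q, evenDigamma (n / q) -
      ∑ j ∈ Finset.range (M + 1), a j * ∑ n ∈ Finset.Ico 1 q, E j (n / q)) := by
    rw [Finset.range_eq_Ico, Finset.sum_eq_sum_Ico_succ_bot hq.pos]
    congr 1
    · simp [hR]
    · simp_rw [Finset.mul_sum]
      rw [Finset.sum_comm, ← Finset.sum_sub_distrib, ← Finset.sum_sub_distrib]
      refine Finset.sum_congr rfl fun n hn => ?_
      rw [Finset.mem_Ico] at hn
      have hn0 : (0 : ℝ) < n := by exact_mod_cast hn.1
      have hn1 : (n : ℝ) / q < 1 := (div_lt_one hq0).mpr (by exact_mod_cast hn.2)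
      have hfr : Int.fract ((n : ℝ) / q) ≠ 0 := by
        rw [Int.fract_eq_self.mpr ⟨by positivity, hn1⟩]
        positivity
      simp only [hR, if_neg hfr]
  have e2 : ∀ j, ∑ n ∈ Finset.Ico 1 q, E j (n / q) =
      2 * ((q : ℂ) ^ singularExponent p j - 1) * riemannZeta (singularExponent p j) := fun j =>
    sum_hurwitzZetaEven hq (singularExponent_ne_one p j)
  have e3 : ∑ j ∈ Finset.range (M + 1), a j * (2 * ((q : ℂ) ^ singularExponent p j - 1) *
      riemannZeta (singularExponent p j)) =
      ∑ j ∈ Finset.range (M + 1), 2 * a j * riemannZeta (singularExponent p j) *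
        (q : ℂ) ^ singularExponent p j -
      ∑ j ∈ Finset.range (M + 1), 2 * a j * riemannZeta (singularExponent p j) := by
    rw [← Finset.sum_sub_distrib]
    exact Finset.sum_congr rfl fun j _ => by ring
  rw [e1, sum_evenDigamma hq]
  simp only [e2]
  rw [e3, hSint, hS, integral_smoothRemainder ha hb, smoothRemainder_zero]
  ring

/-! ### Parseval for the periodic zeta functions. -/

theorem integral_cos_two_pi_int_mul (k : ℤ) :
    ∫ x in (0 : ℝ)..1 / 2, Real.cos (2 * Real.pi * k * x) = if k = 0 then 1 / 2 else 0 := by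
  split_ifs with hk
  · simp [hk]
  · have hk' : (k : ℝ) ≠ 0 := by exact_mod_cast hk
    rw [intervalIntegral.integral_comp_mul_left (fun x => Real.cos x) (by positivity), integral_cos]
    rw [show 2 * Real.pi * k * (1 / 2) = k * Real.pi by ring, Real.sin_int_mul_pi]
    simp

theorem integral_cos_mul_cos (n m : ℕ) :
    ∫ x in (0 : ℝ)..1 / 2, Real.cos (2 * Real.pi * x * (n + 1 : ℕ)) *
      Real.cos (2 * Real.pi * x * (m + 1 : ℕ)) = if n = m then 1 / 4 else 0 := by
  have h : ∀ x : ℝ, Real.cos (2 * Real.pi * x * (n + 1 : ℕ)) *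
      Real.cos (2 * Real.pi * x * (m + 1 : ℕ)) =
      1 / 2 * Real.cos (2 * Real.pi * ((n - m : ℤ) : ℝ) * x) +
      1 / 2 * Real.cos (2 * Real.pi * ((n + m + 2 : ℤ) : ℝ) * x) := fun x => by
    have h1 : 2 * Real.pi * ((n - m : ℤ) : ℝ) * x =
        2 * Real.pi * x * (n + 1 : ℕ) - 2 * Real.pi * x * (m + 1 : ℕ) := by push_cast; ring
    have h2 : 2 * Real.pi * ((n + m + 2 : ℤ) : ℝ) * x =
        2 * Real.pi * x * (n + 1 : ℕ) + 2 * Real.pi * x * (m + 1 : ℕ) := by push_cast; ring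
    rw [h1, h2, Real.cos_sub, Real.cos_add]
    ring
  simp_rw [h]
  rw [integral_add (Continuous.intervalIntegrable (by fun_prop) _ _)
    (Continuous.intervalIntegrable (by fun_prop) _ _), intervalIntegral.integral_const_mul,
    intervalIntegral.integral_const_mul, integral_cos_two_pi_int_mul, integral_cos_two_pi_int_mul]
  rw [if_neg (by omega : ¬ ((n : ℤ) + m + 2 = 0))]
  by_cases hnm : n = m
  · subst hnm; norm_num
  · rw [if_neg hnm, if_neg (by omega)]; norm_num

theorem integral_sin_mul_sin (n m : ℕ) :
    ∫ x in (0 : ℝ)..1 / 2, Real.sin (2 * Real.pi * x * (n + 1 : ℕ)) *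
      Real.sin (2 * Real.pi * x * (m + 1 : ℕ)) = if n = m then 1 / 4 else 0 := by
  have h : ∀ x : ℝ, Real.sin (2 * Real.pi * x * (n + 1 : ℕ)) *
      Real.sin (2 * Real.pi * x * (m + 1 : ℕ)) =
      1 / 2 * Real.cos (2 * Real.pi * ((n - m : ℤ) : ℝ) * x) -
      1 / 2 * Real.cos (2 * Real.pi * ((n + m + 2 : ℤ) : ℝ) * x) := fun x => by
    have h1 : 2 * Real.pi * ((n - m : ℤ) : ℝ) * x =
        2 * Real.pi * x * (n + 1 : ℕ) - 2 * Real.pi * x * (m + 1 : ℕ) := by push_cast; ring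
    have h2 : 2 * Real.pi * ((n + m + 2 : ℤ) : ℝ) * x =
        2 * Real.pi * x * (n + 1 : ℕ) + 2 * Real.pi * x * (m + 1 : ℕ) := by push_cast; ring
    rw [h1, h2, Real.cos_sub, Real.cos_add]
    ring
  simp_rw [h]
  rw [integral_sub (Continuous.intervalIntegrable (by fun_prop) _ _)
    (Continuous.intervalIntegrable (by fun_prop) _ _), intervalIntegral.integral_const_mul,
    intervalIntegral.integral_const_mul, integral_cos_two_pi_int_mul, integral_cos_two_pi_int_mul]
  rw [if_neg (by omega : ¬ ((n : ℤ) + m + 2 = 0))]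
  by_cases hnm : n = m
  · subst hnm; norm_num
  · rw [if_neg hnm, if_neg (by omega)]; norm_num

/-- Bilinear Parseval identity for an absolutely convergent orthogonal expansion. -/
theorem integral_sq_of_orthogonal {c : ℕ → ℂ} (hc : Summable fun n => ‖c n‖) {φ : ℕ → ℝ → ℝ}
    (hφ : ∀ n, Continuous (φ n)) (hφ1 : ∀ n x, |φ n x| ≤ 1)
    (hφo : ∀ n m, ∫ x in (0 : ℝ)..1 / 2, φ n x * φ m x = if n = m then 1 / 4 else 0)
    {f : ℝ → ℂ} (hf : ∀ x, HasSum (fun n => c n * φ n x) (f x)) :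
    HasSum (fun n => c n ^ 2 / 4) (∫ x in (0 : ℝ)..1 / 2, f x ^ 2) := by
  have hterm : ∀ n, Continuous fun x => c n * (φ n x : ℂ) := fun n =>
    continuous_const.mul (Complex.continuous_ofReal.comp (hφ n))
  have hfc : Continuous f := by
    have h1 : f = fun x => ∑' n, c n * (φ n x : ℂ) := funext fun x => (hf x).tsum_eq.symm
    rw [h1]
    refine continuous_tsum hterm hc fun n x => ?_
    rw [norm_mul, Complex.norm_real, Real.norm_eq_abs]
    exact mul_le_of_le_one_right (norm_nonneg _) (hφ1 n x)
  have key : ∀ g : ℝ → ℂ, Continuous g → HasSum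
      (fun n => ∫ x in (0 : ℝ)..1 / 2, c n * φ n x * g x) (∫ x in (0 : ℝ)..1 / 2, f x * g x) := by
    intro g hg
    obtain ⟨B, hB⟩ := (isCompact_uIcc (a := (0 : ℝ)) (b := 1 / 2)).exists_bound_of_continuousOn
      hg.continuousOn
    have hB0 : 0 ≤ B := (norm_nonneg _).trans (hB 0 Set.left_mem_uIcc)
    have h := hasSum_intervalIntegral_of_summable_norm (a := (0 : ℝ)) (b := 1 / 2)
      (f := fun n => (⟨fun x => c n * φ n x * g x, (hterm n).mul hg⟩ : C(ℝ, ℂ))) (by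
        refine .of_nonneg_of_le (fun n => norm_nonneg _) (fun n => ?_) (hc.mul_right B)
        refine (ContinuousMap.norm_le _ (by positivity)).mpr fun x => ?_
        have hx := hB x x.2
        simp only [TopologicalSpace.Compacts.coe_mk, ContinuousMap.restrict_apply,
          ContinuousMap.coe_mk, norm_mul, Complex.norm_real, Real.norm_eq_abs]
        gcongr
        exact mul_le_of_le_one_right (norm_nonneg _) (hφ1 n x))
    simp only [ContinuousMap.coe_mk] at h
    convert! h using 1
    refine integral_congr fun x _ => ?_
    exact ((hf x).mul_right (g x)).tsum_eq.symm
  have h1 : ∀ m, ∫ x in (0 : ℝ)..1 / 2, f x * φ m x = c m / 4 := by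
    intro m
    have h2 := key (fun x => (φ m x : ℂ)) (Complex.continuous_ofReal.comp (hφ m))
    have h3 : ∀ n, ∫ x in (0 : ℝ)..1 / 2, c n * φ n x * φ m x = if n = m then c m / 4 else 0 := by
      intro n
      have h4 : ∀ x, c n * (φ n x : ℂ) * (φ m x : ℂ) = c n * ((φ n x * φ m x : ℝ) : ℂ) := fun x => by
        push_cast; ring
      simp_rw [h4]
      rw [intervalIntegral.integral_const_mul, intervalIntegral.integral_ofReal, hφo]
      split_ifs with hnm
      · subst hnm; push_cast; ring
      · simp
    simp_rw [h3] at h2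
    exact h2.unique (hasSum_ite_eq m _)
  have h5 := key f hfc
  simp_rw [← pow_two] at h5
  convert! h5 using 1
  funext n
  have h6 : ∀ x, c n * (φ n x : ℂ) * f x = c n * (f x * φ n x) := fun x => by ring
  simp_rw [h6]
  rw [intervalIntegral.integral_const_mul, h1]
  ring

theorem summable_norm_one_div_succ_cpow {w : ℂ} (hw : 1 < w.re) :
    Summable fun n : ℕ => ‖1 / ((n + 1 : ℕ) : ℂ) ^ w‖ := by
  have h := (summable_nat_add_iff 1).mpr (Real.summable_one_div_nat_rpow.mpr hw)
  refine h.congr fun n => ?_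
  rw [norm_div, norm_one, Complex.norm_natCast_cpow_of_pos n.succ_pos]

theorem sq_one_div_cpow (n : ℕ) (w : ℂ) :
    (1 / ((n + 1 : ℕ) : ℂ) ^ w) ^ 2 / 4 = 1 / ((n : ℂ) + 1) ^ (2 * w) / 4 := by
  have h : ((n : ℂ) + 1) ≠ 0 := by exact_mod_cast n.succ_ne_zero
  rw [div_pow, one_pow, two_mul, Complex.cpow_add _ _ h, ← pow_two]
  push_cast
  rfl

/-- Using the square rather than the squared modulus keeps the identity holomorphic in `w`, as the
continuation to `s = 1/2` requires. -/
theorem integral_cosZeta_sq {w : ℂ} (hw : 1 < w.re) :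
    ∫ x in (0 : ℝ)..1 / 2, cosZeta x w ^ 2 = riemannZeta (2 * w) / 4 := by
  have h := integral_sq_of_orthogonal (summable_norm_one_div_succ_cpow hw)
    (φ := fun n x => Real.cos (2 * Real.pi * x * (n + 1 : ℕ))) (fun n => by fun_prop)
    (fun n x => Real.abs_cos_le_one _) integral_cos_mul_cos
    (f := fun x => cosZeta x w) fun x => by
      have h1 := (hasSum_nat_add_iff' 1).mpr (hasSum_nat_cosZeta x hw)
      simp only [Finset.sum_range_one, Nat.cast_zero,
        Complex.zero_cpow (show w ≠ 0 by rintro rfl; norm_num at hw), div_zero, sub_zero] at h1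
      convert! h1 using 1
      funext n
      ring
  rw [← h.tsum_eq]
  simp_rw [sq_one_div_cpow]
  have h2 : 1 < (2 * w).re := by simp; linarith
  rw [tsum_div_const, zeta_eq_tsum_one_div_nat_add_one_cpow h2]

theorem integral_sinZeta_sq {w : ℂ} (hw : 1 < w.re) :
    ∫ x in (0 : ℝ)..1 / 2, sinZeta x w ^ 2 = riemannZeta (2 * w) / 4 := by
  have h := integral_sq_of_orthogonal (summable_norm_one_div_succ_cpow hw)
    (φ := fun n x => Real.sin (2 * Real.pi * x * (n + 1 : ℕ))) (fun n => by fun_prop)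
    (fun n x => Real.abs_sin_le_one _) integral_sin_mul_sin
    (f := fun x => sinZeta x w) fun x => by
      have h1 := (hasSum_nat_add_iff' 1).mpr (hasSum_nat_sinZeta x hw)
      simp only [Finset.sum_range_one, Nat.cast_zero,
        Complex.zero_cpow (show w ≠ 0 by rintro rfl; norm_num at hw), div_zero, sub_zero] at h1
      convert! h1 using 1
      funext n
      ring
  rw [← h.tsum_eq]
  simp_rw [sq_one_div_cpow]
  have h2 : 1 < (2 * w).re := by simp; linarith
  rw [tsum_div_const, zeta_eq_tsum_one_div_nat_add_one_cpow h2]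

/-! ### The regularised integral and its value at `1/2`. -/

/-- Holomorphic dependence of an integral on a parameter, under local domination. -/
theorem differentiableOn_integral_of_locally_dominated {U : Set ℂ} (hU : IsOpen U) {μ : Measure ℝ}
    {F : ℂ → ℝ → ℂ} (hmeas : ∀ s ∈ U, AEStronglyMeasurable (F s) μ)
    (hdiff : ∀ᵐ x ∂μ, DifferentiableOn ℂ (fun s => F s x) U)
    (hbound : ∀ s₀ ∈ U, ∃ ε > 0, ∃ g : ℝ → ℝ, Integrable g μ ∧
      ∀ᵐ x ∂μ, ∀ s ∈ Metric.ball s₀ ε, ‖F s x‖ ≤ g x) :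
    DifferentiableOn ℂ (fun s => ∫ x, F s x ∂μ) U := by
  intro s₀ hs₀
  obtain ⟨ε₁, hε₁, g, hg, hgb⟩ := hbound s₀ hs₀
  obtain ⟨ε₂, hε₂, hball⟩ := Metric.isOpen_iff.mp hU s₀ hs₀
  -- Closed discs of radius `δ` about points of `ball s₀ δ` stay in `ball s₀ (2 * δ)`, so Cauchy's
  -- estimate bounds the derivative by `g / δ`.
  set δ := min ε₁ ε₂ / 2 with hδ
  have hδ0 : 0 < δ := by positivity
  have hδ1 : 2 * δ ≤ ε₁ := by rw [hδ]; linarith [min_le_left ε₁ ε₂]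
  have hδ2 : 2 * δ ≤ ε₂ := by rw [hδ]; linarith [min_le_right ε₁ ε₂]
  have hsub : ∀ {s}, s ∈ Metric.ball s₀ δ → Metric.closedBall s δ ⊆ Metric.ball s₀ (2 * δ) := by
    intro s hs z hz
    rw [Metric.mem_ball] at hs ⊢
    rw [Metric.mem_closedBall] at hz
    linarith [dist_triangle z s s₀]
  have hsubU : Metric.ball s₀ (2 * δ) ⊆ U := (Metric.ball_subset_ball hδ2).trans hball
  have hs₀δ : s₀ ∈ Metric.ball s₀ δ := Metric.mem_ball_self hδ0
  have hder : ∀ᵐ x ∂μ, ∀ s ∈ Metric.ball s₀ δ,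
      HasDerivAt (fun s => F s x) (deriv (fun s => F s x) s) s := by
    filter_upwards [hdiff] with x hx s hs
    exact (hx.differentiableAt (hU.mem_nhds (hsubU (hsub hs (Metric.mem_closedBall_self
      hδ0.le))))).hasDerivAt
  -- The derivative is an almost everywhere limit of difference quotients along a sequence, hence
  -- measurable.
  have hmeas' : AEStronglyMeasurable (fun x => deriv (fun s => F s x) s₀) μ := by
    set t : ℕ → ℂ := fun n => s₀ + ((δ * (1 / ((n : ℝ) + 1)) : ℝ) : ℂ) with ht
    have ht0 : Tendsto t atTop (𝓝 s₀) := by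
      have h1 : Tendsto (fun n : ℕ => ((δ * (1 / ((n : ℝ) + 1)) : ℝ) : ℂ)) atTop (𝓝 0) := by
        have := (tendsto_one_div_add_atTop_nhds_zero_nat (𝕜 := ℝ)).const_mul δ
        rw [mul_zero] at this
        exact_mod_cast (Complex.continuous_ofReal.tendsto 0).comp this
      have h2 := h1.const_add s₀
      rw [add_zero] at h2
      exact h2
    have htne : ∀ n, t n ≠ s₀ := fun n => by
      have : (0 : ℝ) < δ * (1 / ((n : ℝ) + 1)) := by positivity
      simp only [ht, ne_eq, add_eq_left, Complex.ofReal_eq_zero]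
      exact this.ne'
    have htU : ∀ n, t n ∈ U := fun n => by
      refine hsubU (hsub hs₀δ ?_)
      have h0 : (0 : ℝ) ≤ δ * (1 / ((n : ℝ) + 1)) := by positivity
      rw [Metric.mem_closedBall, dist_eq_norm, ht, add_sub_cancel_left, Complex.norm_real,
        Real.norm_of_nonneg h0]
      refine mul_le_of_le_one_right hδ0.le ?_
      rw [div_le_one (by positivity)]
      linarith [n.cast_nonneg (α := ℝ)]
    have ht1 : Tendsto t atTop (𝓝[≠] s₀) :=
      tendsto_nhdsWithin_iff.mpr ⟨ht0, Eventually.of_forall htne⟩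
    refine aestronglyMeasurable_of_tendsto_ae atTop
      (f := fun n x => (t n - s₀)⁻¹ • (F (t n) x - F s₀ x)) (fun n => ?_) ?_
    · exact ((hmeas _ (htU n)).sub (hmeas _ hs₀)).const_smul (t n - s₀)⁻¹
    · filter_upwards [hder] with x hx
      exact ((hx s₀ hs₀δ).tendsto_slope).comp ht1
  have h := hasDerivAt_integral_of_dominated_loc_of_deriv_le (μ := μ) (F := F)
    (F' := fun s x => deriv (fun s => F s x) s) (x₀ := s₀) (bound := fun x => g x / δ)
    (Metric.ball_mem_nhds s₀ hδ0)
    (by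
      filter_upwards [Metric.ball_mem_nhds s₀ hδ0] with s hs
      exact hmeas s (hsubU (hsub hs (Metric.mem_closedBall_self hδ0.le))))
    (by
      refine hg.mono' (hmeas _ hs₀) ?_
      filter_upwards [hgb] with x hx
      exact hx s₀ (Metric.mem_ball_self hε₁))
    hmeas'
    (by
      filter_upwards [hgb, hdiff] with x hx hdx s hs
      refine Complex.norm_deriv_le_of_forall_mem_sphere_norm_le hδ0 ?_ fun z hz => ?_
      · refine DifferentiableOn.diffContOnCl ?_
        rw [closure_ball _ hδ0.ne']
        exact hdx.mono ((hsub hs).trans hsubU)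
      · exact hx z (Metric.ball_subset_ball hδ1 (hsub hs (Metric.sphere_subset_closedBall hz))))
    (hg.div_const δ) hder
  exact h.2.differentiableAt.differentiableWithinAt

/-- The part of `2 * hurwitzZetaEven x s` (`p = 0`) or `2 * hurwitzZetaOdd x s` (`p = 1`) that is
regular at `x = 0`. -/
noncomputable def regularPart (p : ℕ) (s : ℂ) (x : ℝ) : ℂ :=
  (if p = 0 then 2 / (s - 1) else 0) + (x : ℂ) ^ p * powSum (signedCoeff p s) ((x : ℂ) ^ 2)

theorem continuousOn_regularPart (p : ℕ) (s : ℂ) :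
    ContinuousOn (regularPart p s) (Set.uIcc 0 (1 / 2)) := by
  unfold regularPart
  refine continuousOn_const.add (ContinuousOn.mul (by fun_prop) ?_)
  exact (radiusGeOne_signedCoeff p s).continuousOn.mono uIcc_zero_half_subset

theorem intervalIntegrable_regularized (p : ℕ) {s : ℂ} (hs : s.re < 1) :
    IntervalIntegrable (fun x : ℝ => 2 * (x : ℂ) ^ (-s) * regularPart p s x + regularPart p s x ^ 2)
      volume 0 (1 / 2) := by
  have hre : -1 < (-s).re := by simpa using hs
  have hc := continuousOn_regularPart p s
  exact (((intervalIntegrable_cpow' hre).const_mul 2).mul_continuousOn hc).add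
    (hc.pow 2).intervalIntegrable

theorem exists_regularPart_bound (p : ℕ) (s₀ : ℂ) (hs₀ : s₀.re < 1) :
    ∃ C : ℝ, ∀ s ∈ Metric.ball s₀ ((1 - s₀.re) / 2), ∀ x ∈ Set.Ioc (0 : ℝ) (1 / 2),
      ‖regularPart p s x‖ ≤ C := by
  obtain ⟨u, hu, hub⟩ := exists_summable_signedCoeff_bound p (‖s₀‖ + (1 - s₀.re) / 2)
    (r := 1 / 4) (by norm_num) (by norm_num)
  refine ⟨2 / ((1 - s₀.re) / 2) + ∑' k, u k, fun s hs x hx => ?_⟩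
  rw [mem_ball_iff_norm] at hs
  have hpos : 0 < (1 - s₀.re) / 2 := by linarith
  refine (norm_add_le _ _).trans (add_le_add ?_ ?_)
  · split_ifs with hp
    · rw [norm_div, Complex.norm_ofNat]
      refine div_le_div_of_nonneg_left (by norm_num) hpos ?_
      have h1 : ‖s₀ - 1‖ ≤ ‖s - s₀‖ + ‖s - 1‖ := by
        have := norm_sub_le (s - 1) (s - s₀)
        rw [show s - 1 - (s - s₀) = s₀ - 1 by ring] at this
        linarith
      have h2 : 1 - s₀.re ≤ ‖s₀ - 1‖ := by
        have := (neg_le_abs _).trans (Complex.abs_re_le_norm (s₀ - 1))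
        simp only [Complex.sub_re, Complex.one_re] at this
        linarith
      linarith
    · rw [norm_zero]; positivity
  · have hx1 : |x| ≤ 1 := by rw [abs_of_pos hx.1]; linarith [hx.2]
    have hsB : ‖s‖ ≤ ‖s₀‖ + (1 - s₀.re) / 2 := by
      have := norm_add_le s₀ (s - s₀)
      rw [add_sub_cancel] at this
      linarith
    have h1 : ‖powSum (signedCoeff p s) ((x : ℂ) ^ 2)‖ ≤ ∑' k, u k := by
      refine tsum_of_norm_bounded hu.hasSum fun k => ?_
      refine le_trans ?_ (hub s hsB k)
      rw [norm_mul, norm_pow, norm_pow, Complex.norm_real, Real.norm_eq_abs]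
      have : |x| ^ 2 ≤ 1 / 4 := by rw [sq_abs]; nlinarith [hx.1, hx.2]
      gcongr
    rw [norm_mul, norm_pow, Complex.norm_real, Real.norm_eq_abs]
    exact (mul_le_of_le_one_left (norm_nonneg _) (pow_le_one₀ (abs_nonneg x) hx1)).trans h1

theorem differentiableOn_regularPart (p : ℕ) {x : ℝ} (hx : |x| < 1) :
    DifferentiableOn ℂ (fun s => regularPart p s x) {s : ℂ | s.re < 1} := by
  unfold regularPart
  refine DifferentiableOn.add ?_ (((differentiable_powSum_signedCoeff p
    (norm_ofReal_sq_lt_one hx)).const_mul _).differentiableOn)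
  split_ifs
  · intro s hs
    have : s - 1 ≠ 0 := fun h => by
      rw [sub_eq_zero] at h
      rw [h] at hs
      simp at hs
    have h2 : DifferentiableAt ℂ (fun s : ℂ => s - 1) s := by fun_prop
    exact ((differentiableAt_const (2 : ℂ)).div h2 this).differentiableWithinAt
  · exact differentiableOn_const _

/-- The regularised integral of the square of a signed Hurwitz zeta function. -/
noncomputable def regularizedIntegral (p : ℕ) (s : ℂ) : ℂ :=
  ∫ x in (0 : ℝ)..1 / 2, (2 * (x : ℂ) ^ (-s) * regularPart p s x + regularPart p s x ^ 2)

theorem isOpen_re_lt_one : IsOpen {s : ℂ | s.re < 1} :=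
  Complex.continuous_re.isOpen_preimage _ isOpen_Iio

theorem differentiableOn_regularizedIntegral (p : ℕ) :
    DifferentiableOn ℂ (regularizedIntegral p) {s : ℂ | s.re < 1} := by
  unfold regularizedIntegral
  simp_rw [integral_of_le (show (0 : ℝ) ≤ 1 / 2 by norm_num)]
  refine differentiableOn_integral_of_locally_dominated isOpen_re_lt_one (fun s hs => ?_) ?_ ?_
  · exact (intervalIntegrable_regularized p hs).1.aestronglyMeasurable
  · filter_upwards [ae_restrict_mem measurableSet_Ioc] with x hx
    have hx1 : |x| < 1 := by rw [abs_of_pos hx.1]; linarith [hx.2]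
    have hx0 : (x : ℂ) ≠ 0 := by exact_mod_cast hx.1.ne'
    have h1 := differentiableOn_regularPart p hx1
    have h2 : DifferentiableOn ℂ (fun s => (x : ℂ) ^ (-s)) {s : ℂ | s.re < 1} := fun s _ =>
      (DifferentiableAt.const_cpow (by fun_prop) (Or.inl hx0)).differentiableWithinAt
    exact ((h2.const_mul 2).mul h1).add (h1.pow 2)
  · intro s₀ hs₀
    have hs₀' : s₀.re < 1 := hs₀
    obtain ⟨C, hC⟩ := exists_regularPart_bound p s₀ hs₀
    -- On this disc `Re s ≤ (1 + Re s₀) / 2 < 1`, so one integrable power of `x` dominates all `x ^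
    -- (-s)`.
    refine ⟨(1 - s₀.re) / 2, by linarith, fun x => 2 * x ^ (-((1 + s₀.re) / 2)) * C + C ^ 2, ?_, ?_⟩
    · have h1 : IntervalIntegrable (fun x : ℝ => 2 * x ^ (-((1 + s₀.re) / 2)) * C + C ^ 2)
          volume 0 (1 / 2) :=
        (((intervalIntegrable_rpow' (by linarith)).const_mul 2).mul_const C).add
          intervalIntegrable_const
      exact h1.1
    · filter_upwards [ae_restrict_mem measurableSet_Ioc] with x hx s hs
      have h1 := hC s hs x hx
      have hre : s.re ≤ (1 + s₀.re) / 2 := by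
        rw [mem_ball_iff_norm] at hs
        have := (le_abs_self _).trans (Complex.abs_re_le_norm (s - s₀))
        simp only [Complex.sub_re] at this
        linarith
      have h2 : ‖(x : ℂ) ^ (-s)‖ ≤ x ^ (-((1 + s₀.re) / 2)) := by
        rw [Complex.norm_cpow_eq_rpow_re_of_pos hx.1]
        exact Real.rpow_le_rpow_of_exponent_ge hx.1 (by linarith [hx.2]) (by simpa using hre)
      refine (norm_add_le _ _).trans ?_
      rw [norm_mul, norm_mul, norm_pow, Complex.norm_ofNat]
      have := Real.rpow_nonneg hx.1.le (-((1 + s₀.re) / 2))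
      gcongr

/-- The omitted term `x ^ (-2s)` of the square is integrated explicitly. It alone obstructs
convergence between `Re s = 1/2` and `Re s = 1`, and it carries the pole at `s = 1/2`. -/
theorem regularizedIntegral_eq_of_integral_sq {p : ℕ} {s : ℂ} (hs : s.re < 0) {A : ℂ}
    (h : ∫ x in (0 : ℝ)..1 / 2, ((x : ℂ) ^ (-s) + regularPart p s x) ^ 2 = A) :
    regularizedIntegral p s + 2 ^ (2 * s - 1) / (1 - 2 * s) = A := by
  have hre : -1 < (-(2 * s)).re := by simp; linarith
  have h0 : -(2 * s) + 1 ≠ 0 := fun h => by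
    have := congrArg Complex.re h
    simp at this
    linarith
  have h1 : ∫ x in (0 : ℝ)..1 / 2, ((x : ℂ) ^ (-s) + regularPart p s x) ^ 2 =
      ∫ x in (0 : ℝ)..1 / 2, ((2 * (x : ℂ) ^ (-s) * regularPart p s x + regularPart p s x ^ 2) +
        (x : ℂ) ^ (-(2 * s))) := by
    refine integral_congr_ae (ae_of_all _ fun x hx => ?_)
    rw [Set.uIoc_of_le (by norm_num)] at hx
    have hx0 : (x : ℂ) ≠ 0 := by exact_mod_cast hx.1.ne'
    rw [show -(2 * s) = -s + -s by ring, Complex.cpow_add _ _ hx0]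
    ring
  rw [← h, h1, integral_add (intervalIntegrable_regularized p (by linarith))
    (intervalIntegrable_cpow' hre), integral_cpow (Or.inl hre), Complex.ofReal_zero,
    Complex.zero_cpow h0, regularizedIntegral]
  have h4 : (((1 / 2 : ℝ) : ℂ)) ^ (-(2 * s) + 1) = 2 ^ (2 * s - 1) := by
    rw [one_div, Complex.ofReal_inv, Complex.inv_cpow _ _ (by
      rw [Complex.arg_ofReal_of_nonneg (by norm_num)]; exact Real.pi_pos.ne), ← Complex.cpow_neg]
    norm_num
    congr 1
    ring
  rw [h4, sub_zero]
  ring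

/-- The functional equation passes to `cosZeta` at `1 - s`, where its series converges absolutely
because `Re (1 - s) > 1`; then Parseval applies. -/
theorem integral_sq_even {s : ℂ} (hs : s.re < 0) :
    ∫ x in (0 : ℝ)..1 / 2, ((x : ℂ) ^ (-s) + regularPart 0 s x) ^ 2 =
      4 * (2 * Real.pi) ^ (-(2 * (1 - s))) * Complex.Gamma (1 - s) ^ 2 *
        Complex.cos (Real.pi * (1 - s) / 2) ^ 2 * riemannZeta (2 * (1 - s)) := by
  have hw : 1 < (1 - s).re := by simp only [Complex.sub_re, Complex.one_re]; linarith
  have hs1 : s ≠ 1 := by rintro rfl; norm_num at hs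
  have h2π : (2 * (Real.pi : ℂ)) ≠ 0 := by simp [Real.pi_ne_zero]
  have h1 : ∫ x in (0 : ℝ)..1 / 2, ((x : ℂ) ^ (-s) + regularPart 0 s x) ^ 2 =
      ∫ x in (0 : ℝ)..1 / 2, (16 * (2 * Real.pi) ^ (-(2 * (1 - s))) * Complex.Gamma (1 - s) ^ 2 *
        Complex.cos (Real.pi * (1 - s) / 2) ^ 2) * cosZeta x (1 - s) ^ 2 := by
    refine integral_congr_ae (ae_of_all _ fun x hx => ?_)
    rw [Set.uIoc_of_le (by norm_num)] at hx
    have h2 := two_mul_hurwitzZetaEven_of_pos hs1 hx.1 (by linarith [hx.2])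
    have h3 := hurwitzZetaEven_one_sub (x : UnitAddCircle) (s := 1 - s) (fun n h => by
      rw [h] at hw
      simp at hw
      linarith [n.cast_nonneg (α := ℝ)]) (Or.inr fun h => by rw [h] at hw; simp at hw)
    rw [sub_sub_cancel] at h3
    rw [regularPart, if_pos rfl, pow_zero, one_mul, ← add_assoc, ← h2, h3,
      show -(2 * (1 - s)) = -(1 - s) + -(1 - s) by ring, Complex.cpow_add _ _ h2π]
    ring
  rw [h1, intervalIntegral.integral_const_mul, integral_cosZeta_sq hw]
  ring

theorem integral_sq_odd {s : ℂ} (hs : s.re < 0) :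
    ∫ x in (0 : ℝ)..1 / 2, ((x : ℂ) ^ (-s) + regularPart 1 s x) ^ 2 =
      4 * (2 * Real.pi) ^ (-(2 * (1 - s))) * Complex.Gamma (1 - s) ^ 2 *
        Complex.sin (Real.pi * (1 - s) / 2) ^ 2 * riemannZeta (2 * (1 - s)) := by
  have hw : 1 < (1 - s).re := by simp only [Complex.sub_re, Complex.one_re]; linarith
  have h2π : (2 * (Real.pi : ℂ)) ≠ 0 := by simp [Real.pi_ne_zero]
  have h1 : ∫ x in (0 : ℝ)..1 / 2, ((x : ℂ) ^ (-s) + regularPart 1 s x) ^ 2 =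
      ∫ x in (0 : ℝ)..1 / 2, (16 * (2 * Real.pi) ^ (-(2 * (1 - s))) * Complex.Gamma (1 - s) ^ 2 *
        Complex.sin (Real.pi * (1 - s) / 2) ^ 2) * sinZeta x (1 - s) ^ 2 := by
    refine integral_congr_ae (ae_of_all _ fun x hx => ?_)
    rw [Set.uIoc_of_le (by norm_num)] at hx
    have h2 := two_mul_hurwitzZetaOdd s hx.1 (by linarith [hx.2])
    have h3 := hurwitzZetaOdd_one_sub (x : UnitAddCircle) (s := 1 - s) (fun n h => by
      rw [h] at hw
      simp at hw
      linarith [n.cast_nonneg (α := ℝ)])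
    rw [sub_sub_cancel] at h3
    rw [regularPart, if_neg one_ne_zero, pow_one, zero_add, ← h2, h3,
      show -(2 * (1 - s)) = -(1 - s) + -(1 - s) by ring, Complex.cpow_add _ _ h2π]
    ring
  rw [h1, intervalIntegral.integral_const_mul, integral_sinZeta_sq hw]
  ring

/-- With `w = 1 - s`, continuation gives `(2 * w - 1) * regularizedIntegral p (1 - w) = Φ w` for `Re
w > 0`. Hence `Φ` vanishes at `1/2` and its derivative there is twice the wanted value. In that
derivative the `γ` from `Γ ^ 2` cancels the `γ` from `ζ`. -/
theorem regularizedIntegral_one_half {p : ℕ} {V : ℂ → ℂ} (hV : Differentiable ℂ V)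
    (hint : ∀ s : ℂ, s.re < 0 → ∫ x in (0 : ℝ)..1 / 2, ((x : ℂ) ^ (-s) + regularPart p s x) ^ 2 =
      4 * (2 * Real.pi) ^ (-(2 * (1 - s))) * Complex.Gamma (1 - s) ^ 2 * V (1 - s) *
        riemannZeta (2 * (1 - s))) {v : ℂ} (hV0 : V (1 / 2) = 1 / 2)
    (hV1 : HasDerivAt V v (1 / 2)) :
    regularizedIntegral p (1 / 2) = v - (Real.log (4 * Real.pi) : ℝ) := by
  set Φ : ℂ → ℂ := fun w => 4 * (2 * Real.pi) ^ (-(2 * w)) * Complex.Gamma w ^ 2 * V w *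
    riemannZeta₁ (2 * w) - 2 ^ (1 - 2 * w) with hΦ
  have h2π : (2 * (Real.pi : ℂ)) ≠ 0 := by simp [Real.pi_ne_zero]
  have hΦd : ∀ w : ℂ, 0 < w.re → DifferentiableAt ℂ Φ w := fun w hw => by
    have hΓ : DifferentiableAt ℂ Complex.Gamma w := Complex.differentiableAt_Gamma w fun m h => by
      rw [h] at hw
      simp at hw
      linarith [m.cast_nonneg (α := ℝ)]
    have e1 : DifferentiableAt ℂ (fun w : ℂ => (2 * (Real.pi : ℂ)) ^ (-(2 * w))) w :=
      DifferentiableAt.const_cpow (by fun_prop) (Or.inl h2π)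
    have e2 : DifferentiableAt ℂ (fun w : ℂ => (2 : ℂ) ^ (1 - 2 * w)) w :=
      DifferentiableAt.const_cpow (by fun_prop) (Or.inl two_ne_zero)
    have e3 := hV w
    fun_prop
  have heq : ∀ s : ℂ, s.re < 1 → (1 - 2 * s) * regularizedIntegral p s = Φ (1 - s) := by
    have hf : AnalyticOnNhd ℂ (fun s => (1 - 2 * s) * regularizedIntegral p s) {s : ℂ | s.re < 1} := by
      refine DifferentiableOn.analyticOnNhd ?_ isOpen_re_lt_one
      have := differentiableOn_regularizedIntegral p
      fun_prop
    have hg : AnalyticOnNhd ℂ (fun s => Φ (1 - s)) {s : ℂ | s.re < 1} := by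
      refine DifferentiableOn.analyticOnNhd (fun s hs => ?_) isOpen_re_lt_one
      have hs' : s.re < 1 := hs
      have := hΦd (1 - s) (by simpa using hs')
      exact (this.comp s (by fun_prop)).differentiableWithinAt
    have hpre : IsPreconnected {s : ℂ | s.re < 1} := (convex_halfSpace_re_lt 1).isPreconnected
    have hmem : {s : ℂ | s.re < 0} ∈ 𝓝 (-1 : ℂ) :=
      (Complex.continuous_re.isOpen_preimage _ isOpen_Iio).mem_nhds (by simp)
    intro s hs
    refine hf.eqOn_of_preconnected_of_eventuallyEq hg hpre
      (show (-1 : ℂ) ∈ {s : ℂ | s.re < 1} by simp) ?_ hs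
    filter_upwards [hmem] with s hs
    have hs' : s.re < 0 := hs
    have h1 := regularizedIntegral_eq_of_integral_sq hs (hint s hs)
    have h2 : 1 - 2 * s ≠ 0 := fun h => by
      have := congrArg Complex.re h
      simp at this
      linarith
    have h3 : 2 * (1 - s) ≠ 1 := fun h => h2 (by linear_combination h)
    rw [riemannZeta_eq_inv_sub_mul h3] at h1
    have h4 : 2 * (1 - s) - 1 = 1 - 2 * s := by ring
    have h5 : 1 - 2 * (1 - s) = 2 * s - 1 := by ring
    rw [h4] at h1
    have h6 : regularizedIntegral p s = 4 * (2 * Real.pi) ^ (-(2 * (1 - s))) *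
      Complex.Gamma (1 - s) ^ 2 * V (1 - s) * ((1 - 2 * s)⁻¹ * riemannZeta₁ (2 * (1 - s))) -
        2 ^ (2 * s - 1) / (1 - 2 * s) := by rw [← h1]; ring
    simp only [hΦ]
    rw [h5, h6]
    field_simp
  -- The product equals `1` at `w = 1/2`, since `Γ(1/2) ^ 2 = π` and `V (1/2) = 1/2`, so its
  -- derivative is the sum of the logarithmic derivatives of its factors.
  have hderiv : HasDerivAt Φ (2 * v - 2 * Complex.log (2 * Real.pi) - 2 * Complex.log 2) (1 / 2) := by
    have hlin : HasDerivAt (fun w : ℂ => 2 * w) 2 (1 / 2) := by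
      simpa using (hasDerivAt_id (1 / 2 : ℂ)).const_mul 2
    have d1 : HasDerivAt (fun w : ℂ => (2 * (Real.pi : ℂ)) ^ (-(2 * w)))
        ((2 * Real.pi) ^ (-(2 * (1 / 2 : ℂ))) * Complex.log (2 * Real.pi) * -2) (1 / 2) :=
      hlin.neg.const_cpow (Or.inl h2π)
    have d2 := Complex.hasDerivAt_Gamma_one_half.pow 2
    have d4 : HasDerivAt (fun w : ℂ => riemannZeta₁ (2 * w)) (Real.eulerMascheroniConstant * 2)
        (1 / 2) := by
      have h1 : HasDerivAt riemannZeta₁ (Real.eulerMascheroniConstant : ℂ) (2 * (1 / 2)) := by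
        rw [mul_one_div_cancel two_ne_zero, ← deriv_riemannZeta₁_one]
        exact (differentiable_riemannZeta₁ 1).hasDerivAt
      exact h1.comp (1 / 2) hlin
    have d5 : HasDerivAt (fun w : ℂ => (2 : ℂ) ^ (1 - 2 * w))
        (2 ^ (1 - 2 * (1 / 2 : ℂ)) * Complex.log 2 * -2) (1 / 2) :=
      (hlin.const_sub 1).const_cpow (Or.inl two_ne_zero)
    have h := ((((d1.const_mul 4).mul d2).mul hV1).mul d4).sub d5
    have hΓ : Complex.Gamma (1 / 2) = (√Real.pi : ℝ) := by
      rw [Complex.Gamma_one_half_eq, Real.sqrt_eq_rpow, Complex.ofReal_cpow Real.pi_pos.le]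
      norm_num
    have hsq : ((√Real.pi : ℝ) : ℂ) ^ 2 = Real.pi := by
      rw [← Complex.ofReal_pow, Real.sq_sqrt Real.pi_pos.le]
    have hπ : (Real.pi : ℂ) ≠ 0 := by exact_mod_cast Real.pi_ne_zero
    convert! h using 1
    simp only [Pi.mul_apply, Pi.pow_apply, hΓ, hV0, mul_one_div_cancel (two_ne_zero (α := ℂ)),
      riemannZeta₁_one, Complex.cpow_neg_one, sub_self, Complex.cpow_zero, hsq]
    field_simp
    simp only [Nat.add_one_sub_one, pow_one]
    linear_combination (8 * (Real.eulerMascheroniConstant : ℂ) + 16 * Complex.log 2) * hsq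
  have hlim : Tendsto (fun w : ℂ => slope Φ (1 / 2) w) (𝓝[≠] (1 / 2))
      (𝓝 (2 * regularizedIntegral p (1 / 2))) := by
    have hc : ContinuousAt (regularizedIntegral p) (1 - 1 / 2) :=
      ((differentiableOn_regularizedIntegral p).differentiableAt
        (isOpen_re_lt_one.mem_nhds (by norm_num))).continuousAt
    have h1 : Tendsto (fun w : ℂ => 2 * regularizedIntegral p (1 - w)) (𝓝[≠] (1 / 2))
        (𝓝 (2 * regularizedIntegral p (1 - 1 / 2))) := by
      refine (Tendsto.const_mul _ (hc.tendsto.comp ?_)).mono_left nhdsWithin_le_nhds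
      exact Continuous.tendsto (f := fun w : ℂ => 1 - w) (by fun_prop) (1 / 2)
    rw [show (1 : ℂ) - 1 / 2 = 1 / 2 by norm_num] at h1
    refine h1.congr' ?_
    have hmem : {w : ℂ | 0 < w.re} ∈ 𝓝[≠] (1 / 2 : ℂ) := mem_nhdsWithin_of_mem_nhds
      ((Complex.continuous_re.isOpen_preimage _ isOpen_Ioi).mem_nhds (by norm_num))
    filter_upwards [hmem, self_mem_nhdsWithin] with w hw hne
    have hw' : 0 < w.re := hw
    have h2 := heq (1 - w) (by simpa using hw')
    have h3 := heq (1 / 2) (by norm_num)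
    rw [sub_sub_cancel] at h2
    rw [mul_one_div_cancel two_ne_zero, sub_self, zero_mul,
      show (1 : ℂ) - 1 / 2 = 1 / 2 by norm_num] at h3
    have hne' : w - 1 / 2 ≠ 0 := sub_ne_zero.mpr hne
    rw [slope_def_field, ← h3, sub_zero, ← h2, eq_div_iff hne']
    ring
  have hfin := tendsto_nhds_unique hlim hderiv.tendsto_slope
  have hlog1 : Complex.log (2 * Real.pi) = (Real.log (2 * Real.pi) : ℝ) := by
    rw [Complex.ofReal_log (by positivity)]; norm_num
  have hlog2 : Complex.log 2 = (Real.log 2 : ℝ) := by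
    rw [Complex.ofReal_log (by norm_num)]; norm_num
  have hlog3 : Real.log (4 * Real.pi) = Real.log 2 + Real.log (2 * Real.pi) := by
    rw [← Real.log_mul (by norm_num) (by positivity)]
    congr 1
    ring
  rw [hlog1, hlog2] at hfin
  rw [hlog3]
  push_cast
  linear_combination hfin / 2

theorem hasDerivAt_pi_mul_div_two (w : ℂ) :
    HasDerivAt (fun w : ℂ => (Real.pi : ℂ) * w / 2) (Real.pi / 2) w := by
  simpa using ((hasDerivAt_id w).const_mul (Real.pi : ℂ)).div_const 2

theorem regularizedIntegral_even :
    regularizedIntegral 0 (1 / 2) = -(Real.pi : ℂ) / 2 - (Real.log (4 * Real.pi) : ℝ) := by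
  have h2 : ((√2 : ℝ) : ℂ) ^ 2 = 2 := by
    rw [← Complex.ofReal_pow, Real.sq_sqrt (by norm_num)]; norm_num
  have h4 : (Real.pi : ℂ) * (1 / 2) / 2 = ((Real.pi / 4 : ℝ) : ℂ) := by push_cast; ring
  refine regularizedIntegral_one_half (V := fun w => Complex.cos (Real.pi * w / 2) ^ 2)
    (by fun_prop) (fun s hs => integral_sq_even hs) ?_ ?_
  · rw [h4, ← Complex.ofReal_cos, Real.cos_pi_div_four]
    push_cast
    rw [div_pow, h2]
    norm_num
  · have h := ((hasDerivAt_pi_mul_div_two (1 / 2)).ccos).pow 2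
    convert! h using 1
    rw [h4, ← Complex.ofReal_cos, ← Complex.ofReal_sin, Real.cos_pi_div_four,
      Real.sin_pi_div_four]
    push_cast
    simp only [pow_one]
    linear_combination (Real.pi / 4 : ℂ) * h2

theorem regularizedIntegral_odd :
    regularizedIntegral 1 (1 / 2) = (Real.pi : ℂ) / 2 - (Real.log (4 * Real.pi) : ℝ) := by
  have h2 : ((√2 : ℝ) : ℂ) ^ 2 = 2 := by
    rw [← Complex.ofReal_pow, Real.sq_sqrt (by norm_num)]; norm_num
  have h4 : (Real.pi : ℂ) * (1 / 2) / 2 = ((Real.pi / 4 : ℝ) : ℂ) := by push_cast; ring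
  refine regularizedIntegral_one_half (V := fun w => Complex.sin (Real.pi * w / 2) ^ 2)
    (by fun_prop) (fun s hs => integral_sq_odd hs) ?_ ?_
  · rw [h4, ← Complex.ofReal_sin, Real.sin_pi_div_four]
    push_cast
    rw [div_pow, h2]
    norm_num
  · have h := ((hasDerivAt_pi_mul_div_two (1 / 2)).csin).pow 2
    convert! h using 1
    rw [h4, ← Complex.ofReal_cos, ← Complex.ofReal_sin, Real.cos_pi_div_four,
      Real.sin_pi_div_four]
    push_cast
    simp only [pow_one]
    linear_combination (-Real.pi / 4 : ℂ) * h2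

/-! ### Squaring the local expansions, and the resulting asymptotics. -/

/-- Coefficients of the product of two power series. -/
noncomputable def cauchyProd (a b : ℕ → ℂ) (n : ℕ) : ℂ :=
  ∑ kl ∈ Finset.HasAntidiagonal.antidiagonal n, a kl.1 * b kl.2

theorem cauchyProd_mul_pow (a b : ℕ → ℂ) (y : ℂ) (n : ℕ) :
    cauchyProd a b n * y ^ n =
      ∑ kl ∈ Finset.HasAntidiagonal.antidiagonal n, (a kl.1 * y ^ kl.1) * (b kl.2 * y ^ kl.2) := by
  rw [cauchyProd, Finset.sum_mul]
  refine Finset.sum_congr rfl fun kl hkl => ?_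
  rw [← Finset.HasAntidiagonal.mem_antidiagonal.mp hkl, pow_add]
  ring

theorem RadiusGeOne.cauchyProd {a b : ℕ → ℂ} (ha : RadiusGeOne a) (hb : RadiusGeOne b) :
    RadiusGeOne (cauchyProd a b) := by
  intro r hr hr1
  have hn : ∀ (c : ℕ → ℂ) (k : ℕ), ‖c k * (r : ℂ) ^ k‖ = ‖c k‖ * r ^ k := fun c k => by
    rw [norm_mul, norm_pow, Complex.norm_real, Real.norm_of_nonneg hr]
  have h := summable_norm_sum_mul_antidiagonal_of_summable_norm
    (f := fun k => a k * (r : ℂ) ^ k) (g := fun k => b k * (r : ℂ) ^ k)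
    (by simpa only [hn] using ha r hr hr1) (by simpa only [hn] using hb r hr hr1)
  simpa only [← cauchyProd_mul_pow, hn] using h

theorem powSum_cauchyProd {a b : ℕ → ℂ} (ha : RadiusGeOne a) (hb : RadiusGeOne b) {y : ℂ}
    (hy : ‖y‖ < 1) : powSum (cauchyProd a b) y = powSum a y * powSum b y := by
  have h := tsum_mul_tsum_eq_tsum_sum_antidiagonal_of_summable_norm
    (f := fun k => a k * y ^ k) (g := fun k => b k * y ^ k)
    (by simpa using ha ‖y‖ (norm_nonneg y) hy) (by simpa using hb ‖y‖ (norm_nonneg y) hy)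
  rw [powSum, powSum, powSum, h]
  exact tsum_congr fun n => cauchyProd_mul_pow a b y n

/-- Coefficients of `y * powSum a y`. -/
def mulVarCoeff (a : ℕ → ℂ) : ℕ → ℂ
  | 0 => 0
  | k + 1 => a k

theorem RadiusGeOne.mulVarCoeff {a : ℕ → ℂ} (ha : RadiusGeOne a) : RadiusGeOne (mulVarCoeff a) := by
  intro r hr hr1
  refine (summable_nat_add_iff 1).mp (((ha r hr hr1).mul_right r).congr fun k => ?_)
  simp only [_root_.mulVarCoeff]
  ring

theorem powSum_mulVarCoeff {a : ℕ → ℂ} (ha : RadiusGeOne a) {y : ℂ} (hy : ‖y‖ < 1) :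
    powSum (mulVarCoeff a) y = y * powSum a y := by
  rw [powSum, (ha.mulVarCoeff.summable hy).tsum_eq_zero_add, powSum, ← tsum_mul_left]
  simp only [mulVarCoeff, zero_mul, zero_add]
  exact tsum_congr fun k => by ring

theorem RadiusGeOne.const_mul {a : ℕ → ℂ} (ha : RadiusGeOne a) (c : ℂ) :
    RadiusGeOne fun k => c * a k := fun r hr hr1 => by
  simpa only [norm_mul, mul_assoc] using (ha r hr hr1).mul_left ‖c‖

theorem powSum_const_mul (a : ℕ → ℂ) (c y : ℂ) :
    powSum (fun k => c * a k) y = c * powSum a y := by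
  simp only [powSum, mul_assoc, tsum_mul_left]

/-- Taylor coefficients in `x ^ 2` of the regular part of `2 * hurwitzZetaEven x (1 / 2)`. -/
noncomputable def evenCoeff (k : ℕ) : ℂ := signedCoeff 0 (1 / 2) k + if k = 0 then -4 else 0

theorem radiusGeOne_evenCoeff : RadiusGeOne evenCoeff := by
  intro r hr hr1
  refine (radiusGeOne_signedCoeff 0 (1 / 2) r hr hr1).congr_cofinite ?_
  refine (Set.finite_singleton 0).subset fun k hk => ?_
  by_contra h
  have h' : ¬ k = 0 := h
  exact hk (by show _ = _; simp only [evenCoeff]; rw [if_neg h', add_zero])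

/-- The constant `-4` is the polar term `2 / (s - 1)` at `s = 1/2`. -/
theorem powSum_evenCoeff {y : ℂ} (hy : ‖y‖ < 1) :
    powSum evenCoeff y = -4 + powSum (signedCoeff 0 (1 / 2)) y := by
  have h1 := ((radiusGeOne_signedCoeff 0 (1 / 2)).summable hy).hasSum
  have h2 := (hasSum_ite_eq 0 (-4 : ℂ)).add h1
  rw [← powSum] at h2
  rw [← h2.tsum_eq, powSum]
  refine tsum_congr fun k => ?_
  rw [evenCoeff]
  split_ifs with hk
  · subst hk; simp; ring
  · ring

theorem evenCoeff_zero : evenCoeff 0 = 2 * riemannZeta (1 / 2) := by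
  rw [riemannZeta_eq_inv_sub_add (by norm_num)]
  norm_num [evenCoeff, signedCoeff, hurwitzCoeff]
  ring

/-- The error-free part of the expansion common to both parities. -/
noncomputable def leadingTerm (I : ℂ) (q : ℕ) : ℂ :=
  2 * q * (Real.log q + Real.eulerMascheroniConstant) + 2 * q * (I - (Real.log 2 : ℝ))

theorem ofReal_cpow_neg_one_half_sq {x : ℝ} (hx : 0 < x) :
    ((x : ℂ) ^ (-(1 / 2) : ℂ)) ^ 2 = (x : ℂ)⁻¹ := by
  have hx0 : (x : ℂ) ≠ 0 := by exact_mod_cast hx.ne'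
  rw [pow_two, ← Complex.cpow_add _ _ hx0, ← Complex.cpow_neg_one]
  norm_num

/-- The square of `|x| ^ (-1/2) + E(x ^ 2)` has the required shape with `p = 0`, `a = 2E` and `b = E
^ 2`; here `E(0) = 2 * ζ(1/2)` supplies the constant term. -/
theorem exists_even_expansion (M : ℕ) : ∃ C : ℝ, ∀ q : ℕ, q.Prime →
    ‖∑ n ∈ Finset.Ico 1 q, (2 * hurwitzZetaEven (((n : ℝ) / q : ℝ) : UnitAddCircle) (1 / 2)) ^ 2 -
      (leadingTerm (regularizedIntegral 0 (1 / 2)) q - 4 * riemannZeta (1 / 2) ^ 2 +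
        ∑ j ∈ Finset.range (M + 1), 2 * (2 * evenCoeff j) * riemannZeta (singularExponent 0 j) *
          (q : ℂ) ^ singularExponent 0 j)‖ ≤ C * q / (q : ℝ) ^ (2 * M) := by
  have hE := radiusGeOne_evenCoeff
  have h := exists_sum_sub_le_of_singular
    (h := fun x : ℝ => (2 * hurwitzZetaEven x (1 / 2)) ^ 2) (fun x => by simp) (p := 0)
    (hE.const_mul 2) (hE.cauchyProd hE) (fun x hx hx1 => by
      have hy := norm_ofReal_sq_lt_one hx1
      rw [two_mul_hurwitzZetaEven (by norm_num) hx hx1, powSum_const_mul, powSum_cauchyProd hE hE hy,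
        powSum_evenCoeff hy, ← ofReal_cpow_neg_one_half_sq (abs_pos.mpr hx)]
      norm_num
      ring) M
  have hI : ∫ x in (0 : ℝ)..1 / 2, ((x : ℂ) ^ (((0 : ℕ) : ℂ) - 1 / 2) *
      powSum (fun k => 2 * evenCoeff k) ((x : ℂ) ^ 2) +
        powSum (cauchyProd evenCoeff evenCoeff) ((x : ℂ) ^ 2)) =
      regularizedIntegral 0 (1 / 2) := by
    refine integral_congr_ae (ae_of_all _ fun x hx => ?_)
    rw [Set.uIoc_of_le (by norm_num)] at hx
    have hy := norm_ofReal_sq_lt_one (x := x) (by rw [abs_of_pos hx.1]; linarith [hx.2])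
    rw [powSum_const_mul, powSum_cauchyProd hE hE hy, powSum_evenCoeff hy, regularPart]
    norm_num
    ring
  have hb0 : cauchyProd evenCoeff evenCoeff 0 = 4 * riemannZeta (1 / 2) ^ 2 := by
    simp only [cauchyProd, Finset.HasAntidiagonal.antidiagonal_zero, Finset.sum_singleton, evenCoeff_zero]
    ring
  rw [hI, hb0] at h
  exact h

/-- The square of `|x| ^ (-1/2) + |x| * e(x ^ 2)` has `p = 1`, `a = 2e` and `b = y * e ^ 2` in `y =
x ^ 2`. So `b 0 = 0`, and neither a constant nor a `q ^ (1/2)` term occurs. -/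
theorem exists_odd_expansion (M : ℕ) : ∃ C : ℝ, ∀ q : ℕ, q.Prime →
    ‖∑ n ∈ Finset.Ico 1 q, (2 * hurwitzZetaOdd (((n : ℝ) / q : ℝ) : UnitAddCircle) (1 / 2)) ^ 2 -
      (leadingTerm (regularizedIntegral 1 (1 / 2)) q +
        ∑ j ∈ Finset.range (M + 1), 2 * (2 * signedCoeff 1 (1 / 2) j) *
          riemannZeta (singularExponent 1 j) * (q : ℂ) ^ singularExponent 1 j)‖ ≤
      C * q / (q : ℝ) ^ (2 * M) := by
  have hE := radiusGeOne_signedCoeff 1 (1 / 2)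
  set e := signedCoeff 1 (1 / 2) with he
  have hcpow : ∀ x : ℝ, 0 < x →
      (x : ℂ) ^ (((1 : ℕ) : ℂ) - 1 / 2) = (x : ℂ) ^ (-(1 / 2) : ℂ) * x := fun x hx => by
    have hx0 : (x : ℂ) ≠ 0 := by exact_mod_cast hx.ne'
    rw [show ((1 : ℕ) : ℂ) - 1 / 2 = -(1 / 2) + 1 by norm_num, Complex.cpow_add _ _ hx0,
      Complex.cpow_one]
  have h := exists_sum_sub_le_of_singular
    (h := fun x : ℝ => (2 * hurwitzZetaOdd x (1 / 2)) ^ 2) (fun x => by simp) (p := 1)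
    (hE.const_mul 2) (hE.cauchyProd hE.mulVarCoeff) (fun x hx hx1 => by
      have hy := norm_ofReal_sq_lt_one hx1
      have h1 := two_mul_hurwitzZetaOdd (1 / 2) (abs_pos.mpr hx) hx1
      have h2 : ((|x| : ℝ) : ℂ) ^ 2 = (x : ℂ) ^ 2 := by
        rw [← Complex.ofReal_pow, sq_abs, Complex.ofReal_pow]
      have h3 : (2 * hurwitzZetaOdd (x : UnitAddCircle) (1 / 2)) ^ 2 =
          (2 * hurwitzZetaOdd ((|x| : ℝ) : UnitAddCircle) (1 / 2)) ^ 2 := by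
        rcases abs_choice x with hx | hx <;> rw [hx]
        rw [AddCircle.coe_neg, hurwitzZetaOdd_neg]
        ring
      rw [h3, h1, h2, powSum_const_mul, powSum_cauchyProd hE hE.mulVarCoeff hy,
        powSum_mulVarCoeff hE hy, ← ofReal_cpow_neg_one_half_sq (abs_pos.mpr hx),
        hcpow _ (abs_pos.mpr hx), ← he]
      linear_combination (powSum e ((x : ℂ) ^ 2)) ^ 2 * h2) M
  have hI : ∫ x in (0 : ℝ)..1 / 2, ((x : ℂ) ^ (((1 : ℕ) : ℂ) - 1 / 2) *
      powSum (fun k => 2 * e k) ((x : ℂ) ^ 2) +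
        powSum (cauchyProd e (mulVarCoeff e)) ((x : ℂ) ^ 2)) =
      regularizedIntegral 1 (1 / 2) := by
    refine integral_congr_ae (ae_of_all _ fun x hx => ?_)
    rw [Set.uIoc_of_le (by norm_num)] at hx
    have hy := norm_ofReal_sq_lt_one (x := x) (by rw [abs_of_pos hx.1]; linarith [hx.2])
    rw [powSum_const_mul, powSum_cauchyProd hE hE.mulVarCoeff hy, powSum_mulVarCoeff hE hy,
      hcpow _ hx.1, regularPart, if_neg one_ne_zero, ← he]
    ring
  have hb0 : cauchyProd e (mulVarCoeff e) 0 = 0 := by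
    simp [cauchyProd, mulVarCoeff]
  rw [hI, hb0] at h
  simp only [sub_zero] at h
  exact h

/-! ### Reality at `s = 1/2`, identifying squared moduli with squares. -/

theorem conj_riemannZeta_of_real {s : ℂ} (hs : conj s = s) :
    conj (riemannZeta s) = riemannZeta s := by
  rw [← riemannZeta_conj, hs]

theorem conj_one_half : conj (1 / 2 : ℂ) = 1 / 2 := by
  rw [map_div₀, map_one, map_ofNat]

theorem conj_hurwitzCoeff_one_half (k : ℕ) :
    conj (hurwitzCoeff k (1 / 2)) = hurwitzCoeff k (1 / 2) := by
  cases k with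
  | zero =>
    have h : riemannZeta₀ (1 / 2) = riemannZeta (1 / 2) - (1 / 2 - 1)⁻¹ := by
      rw [riemannZeta_eq_inv_sub_add (by norm_num)]; ring
    simp only [hurwitzCoeff]
    rw [h, map_sub, conj_riemannZeta_of_real conj_one_half, map_inv₀, map_sub, conj_one_half,
      map_one]
  | succ k =>
    have hs : (1 / 2 + k + 1 : ℂ) ≠ 1 := fun h => by
      have := congrArg Complex.re h
      norm_num at this
      have h2 : (0 : ℝ) ≤ k := k.cast_nonneg
      linarith
    have h : riemannZeta₁ (1 / 2 + k + 1) =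
        (1 / 2 + k) * riemannZeta (1 / 2 + k + 1) := by
      rw [riemannZeta_eq_inv_sub_mul hs]
      have : (1 / 2 + k : ℂ) ≠ 0 := fun h => hs (by rw [h, zero_add])
      rw [add_sub_cancel_right, ← mul_assoc, mul_inv_cancel₀ this, one_mul]
    have h2 : Ring.choose (-(1 / 2) : ℂ) k = ((Ring.choose (-(1 / 2) : ℝ) k : ℝ) : ℂ) := by
      rw [Complex.ofReal_choose]; norm_num
    simp only [hurwitzCoeff]
    rw [h, h2, map_neg, map_div₀, map_mul, map_mul, Complex.conj_ofReal,
      conj_riemannZeta_of_real (by simp [map_ofNat])]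
    simp [map_ofNat]

theorem conj_powSum {a : ℕ → ℂ} (ha : ∀ k, conj (a k) = a k) {y : ℂ} (hy : conj y = y) :
    conj (powSum a y) = powSum a y := by
  rw [powSum, Complex.conj_tsum]
  exact tsum_congr fun k => by rw [map_mul, map_pow, ha, hy]

theorem conj_signedCoeff_one_half (p k : ℕ) :
    conj (signedCoeff p (1 / 2) k) = signedCoeff p (1 / 2) k := by
  rw [signedCoeff, map_mul, conj_hurwitzCoeff_one_half, map_ofNat]

theorem conj_ofReal_cpow_neg_one_half {x : ℝ} (hx : 0 ≤ x) :
    conj ((x : ℂ) ^ (-(1 / 2) : ℂ)) = (x : ℂ) ^ (-(1 / 2) : ℂ) := by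
  have : (-(1 / 2) : ℂ) = ((-(1 / 2) : ℝ) : ℂ) := by norm_num
  rw [this, ← Complex.ofReal_cpow hx, Complex.conj_ofReal]

theorem conj_two_mul_hurwitzZetaEven {x : ℝ} (hx : 0 < x) (hx1 : x < 1) :
    conj (2 * hurwitzZetaEven x (1 / 2)) = 2 * hurwitzZetaEven x (1 / 2) := by
  rw [two_mul_hurwitzZetaEven (by norm_num) hx.ne' (by rwa [abs_of_pos hx]), map_add, map_add,
    conj_powSum (conj_signedCoeff_one_half 0) (by simp),
    conj_ofReal_cpow_neg_one_half (abs_nonneg x)]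
  simp [map_ofNat]

theorem conj_two_mul_hurwitzZetaOdd {x : ℝ} (hx : 0 < x) (hx1 : x < 1) :
    conj (2 * hurwitzZetaOdd x (1 / 2)) = 2 * hurwitzZetaOdd x (1 / 2) := by
  rw [two_mul_hurwitzZetaOdd _ hx hx1, map_add, map_mul,
    conj_powSum (conj_signedCoeff_one_half 1) (by simp),
    conj_ofReal_cpow_neg_one_half hx.le, Complex.conj_ofReal]

theorem Complex.ofReal_norm_sq_of_conj {z : ℂ} (hz : conj z = z) : ((‖z‖ ^ 2 : ℝ) : ℂ) = z ^ 2 := by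
  rw [Complex.ofReal_pow, ← Complex.mul_conj', hz, pow_two]

/-! ### Moments of `L`-functions as sums of Hurwitz zeta values. -/

/-- Plancherel's identity for the characters modulo a prime. -/
theorem DirichletCharacter.sum_norm_sq_sum_mul (q : ℕ) [Fact q.Prime] (g : ZMod q → ℂ) :
    ∑ χ : DirichletCharacter ℂ q, ((‖∑ j, χ j * g j‖ ^ 2 : ℝ) : ℂ) =
      ((q : ℂ) - 1) * ∑ j with j ≠ 0, ((‖g j‖ ^ 2 : ℝ) : ℂ) := by
  have hq : 1 ≤ q := (Fact.out : q.Prime).one_le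
  calc ∑ χ : DirichletCharacter ℂ q, ((‖∑ j, χ j * g j‖ ^ 2 : ℝ) : ℂ)
      = ∑ χ : DirichletCharacter ℂ q, ∑ i with i ≠ 0, ∑ j, χ i⁻¹ * χ j * (conj (g i) * g j) := by
        refine Finset.sum_congr rfl fun χ _ => ?_
        rw [Complex.ofReal_pow, ← Complex.mul_conj', mul_comm, map_sum, Finset.sum_mul_sum]
        -- The terms with `i = 0` vanish since `χ 0 = 0`; orthogonality needs `i` to be a unit.
        rw [← Finset.sum_filter_add_sum_filter_not Finset.univ (fun i : ZMod q => i ≠ 0),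
          add_eq_left.mpr]
        · refine Finset.sum_congr rfl fun i hi => Finset.sum_congr rfl fun j _ => ?_
          have h1 : conj (χ i) = χ i⁻¹ := by
            have h2 := MulChar.star_apply' χ i
            rw [MulChar.inv_apply'] at h2
            exact h2
          rw [map_mul, h1]
          ring
        · refine Finset.sum_eq_zero fun i hi => Finset.sum_eq_zero fun j _ => ?_
          have : i = 0 := by simpa using hi
          rw [this, MulChar.map_zero]
          simp
    _ = ∑ i : ZMod q with i ≠ 0, ∑ j, (∑ χ : DirichletCharacter ℂ q, χ i⁻¹ * χ j) *
          (conj (g i) * g j) := by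
        rw [Finset.sum_comm]
        refine Finset.sum_congr rfl fun i _ => ?_
        rw [Finset.sum_comm]
        exact Finset.sum_congr rfl fun j _ => (Finset.sum_mul ..).symm
    _ = _ := by
        rw [Finset.mul_sum]
        refine Finset.sum_congr rfl fun i hi => ?_
        have hi : i ≠ 0 := by simpa using hi
        simp only [DirichletCharacter.sum_char_inv_mul_char_eq ℂ (isUnit_iff_ne_zero.mpr hi),
          ite_mul, zero_mul, Finset.sum_ite_eq, Finset.mem_univ, if_true]
        rw [Nat.totient_prime Fact.out, Nat.cast_sub hq, Complex.ofReal_pow, ← Complex.mul_conj',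
          mul_comm (g i), Nat.cast_one]

theorem DirichletCharacter.sum_mul_eq_zero_of_odd_of_even {q : ℕ} [NeZero q]
    {χ : DirichletCharacter ℂ q} (hχ : χ.Odd) {g : ZMod q → ℂ} (hg : g.Even) :
    ∑ j, χ j * g j = 0 := by
  refine Function.Odd.sum_eq_zero fun j => ?_
  rw [hχ.eval_neg, hg j, neg_mul]

theorem DirichletCharacter.sum_mul_eq_zero_of_even_of_odd {q : ℕ} [NeZero q]
    {χ : DirichletCharacter ℂ q} (hχ : χ.Even) {g : ZMod q → ℂ} (hg : g.Odd) :
    ∑ j, χ j * g j = 0 := by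
  refine Function.Odd.sum_eq_zero fun j => ?_
  rw [hχ.eval_neg, hg j, mul_neg]

theorem norm_natCast_cpow_neg_one_half_mul_sq {q : ℕ} (hq : 0 < q) (z : ℂ) :
    ‖(q : ℂ) ^ (-(1 / 2) : ℂ) * z‖ ^ 2 = (q : ℝ)⁻¹ * ‖z‖ ^ 2 := by
  rw [norm_mul, mul_pow, ← norm_pow]
  have := ofReal_cpow_neg_one_half_sq (x := q) (by exact_mod_cast hq)
  rw [Complex.ofReal_natCast] at this
  rw [this, norm_inv, Complex.norm_natCast]

theorem natCast_div_mem_Ioo {q n : ℕ} (hn : n ∈ Finset.Ico 1 q) :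
    0 < (n : ℝ) / q ∧ (n : ℝ) / q < 1 := by
  rw [Finset.mem_Ico] at hn
  have h1 : (0 : ℝ) < n := by exact_mod_cast hn.1
  have h2 : (n : ℝ) < q := by exact_mod_cast hn.2
  exact ⟨div_pos h1 (h1.trans h2), (div_lt_one (h1.trans h2)).mpr h2⟩

-- Plancherel runs over all characters, but an odd character is orthogonal to an even function, so
-- the full sum already is the sum over even characters.
open scoped Classical in
theorem sum_even_norm_LFunction_sq (q : ℕ) [Fact q.Prime] :
    ((∑ χ : DirichletCharacter ℂ q with χ.Even,
      ‖DirichletCharacter.LFunction χ (1 / 2)‖ ^ 2 : ℝ) : ℂ) =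
      ((q : ℂ) - 1) / (4 * q) * ∑ n ∈ Finset.Ico 1 q,
        (2 * hurwitzZetaEven (((n : ℝ) / q : ℝ) : UnitAddCircle) (1 / 2)) ^ 2 := by
  have hq0 : 0 < q := (Fact.out : q.Prime).pos
  have hg : Function.Even fun j : ZMod q => hurwitzZetaEven (ZMod.toAddCircle j) (1 / 2) :=
    fun j => by simp only [map_neg, hurwitzZetaEven_neg]
  have h := DirichletCharacter.sum_norm_sq_sum_mul q
    fun j : ZMod q => hurwitzZetaEven (ZMod.toAddCircle j) (1 / 2)
  rw [ZMod.sum_ne_zero_toAddCircle fun x => ((‖hurwitzZetaEven x (1 / 2)‖ ^ 2 : ℝ) : ℂ)] at h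
  rw [← Finset.sum_filter_add_sum_filter_not Finset.univ
    (fun χ : DirichletCharacter ℂ q => χ.Even), add_eq_left.mpr] at h
  · rw [Complex.ofReal_sum]
    have h1 : ∀ χ ∈ Finset.univ.filter fun χ : DirichletCharacter ℂ q => χ.Even,
        ((‖DirichletCharacter.LFunction χ (1 / 2)‖ ^ 2 : ℝ) : ℂ) = (q : ℂ)⁻¹ *
          ((‖∑ j, χ j * hurwitzZetaEven (ZMod.toAddCircle j) (1 / 2)‖ ^ 2 : ℝ) : ℂ) := by
      intro χ hχ
      rw [DirichletCharacter.LFunction, ZMod.LFunction_def_even (Finset.mem_filter.mp hχ).2.to_fun,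
        norm_natCast_cpow_neg_one_half_mul_sq hq0, Complex.ofReal_mul, Complex.ofReal_inv,
        Complex.ofReal_natCast]
    rw [Finset.sum_congr rfl h1, ← Finset.mul_sum, h, Finset.mul_sum, Finset.mul_sum,
      Finset.mul_sum]
    refine Finset.sum_congr rfl fun n hn => ?_
    obtain ⟨h2, h3⟩ := natCast_div_mem_Ioo hn
    have h4 := Complex.ofReal_norm_sq_of_conj (conj_two_mul_hurwitzZetaEven h2 h3)
    rw [← h4, norm_mul, Complex.norm_ofNat]
    push_cast
    have : (q : ℂ) ≠ 0 := by exact_mod_cast hq0.ne'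
    field_simp
    ring
  · refine Finset.sum_eq_zero fun χ hχ => ?_
    have h1 : χ.Odd := χ.even_or_odd.resolve_left (Finset.mem_filter.mp hχ).2
    rw [DirichletCharacter.sum_mul_eq_zero_of_odd_of_even h1 hg]
    simp

open scoped Classical in
theorem sum_odd_norm_LFunction_sq (q : ℕ) [Fact q.Prime] :
    ((∑ χ : DirichletCharacter ℂ q with χ.Odd,
      ‖DirichletCharacter.LFunction χ (1 / 2)‖ ^ 2 : ℝ) : ℂ) =
      ((q : ℂ) - 1) / (4 * q) * ∑ n ∈ Finset.Ico 1 q,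
        (2 * hurwitzZetaOdd (((n : ℝ) / q : ℝ) : UnitAddCircle) (1 / 2)) ^ 2 := by
  have hq0 : 0 < q := (Fact.out : q.Prime).pos
  have hg : Function.Odd fun j : ZMod q => hurwitzZetaOdd (ZMod.toAddCircle j) (1 / 2) :=
    fun j => by simp only [map_neg, hurwitzZetaOdd_neg]
  have h := DirichletCharacter.sum_norm_sq_sum_mul q
    fun j : ZMod q => hurwitzZetaOdd (ZMod.toAddCircle j) (1 / 2)
  rw [ZMod.sum_ne_zero_toAddCircle fun x => ((‖hurwitzZetaOdd x (1 / 2)‖ ^ 2 : ℝ) : ℂ)] at h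
  rw [← Finset.sum_filter_add_sum_filter_not Finset.univ
    (fun χ : DirichletCharacter ℂ q => χ.Odd), add_eq_left.mpr] at h
  · rw [Complex.ofReal_sum]
    have h1 : ∀ χ ∈ Finset.univ.filter fun χ : DirichletCharacter ℂ q => χ.Odd,
        ((‖DirichletCharacter.LFunction χ (1 / 2)‖ ^ 2 : ℝ) : ℂ) = (q : ℂ)⁻¹ *
          ((‖∑ j, χ j * hurwitzZetaOdd (ZMod.toAddCircle j) (1 / 2)‖ ^ 2 : ℝ) : ℂ) := by
      intro χ hχ
      rw [DirichletCharacter.LFunction, ZMod.LFunction_def_odd (Finset.mem_filter.mp hχ).2.to_fun,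
        norm_natCast_cpow_neg_one_half_mul_sq hq0, Complex.ofReal_mul, Complex.ofReal_inv,
        Complex.ofReal_natCast]
    rw [Finset.sum_congr rfl h1, ← Finset.mul_sum, h, Finset.mul_sum, Finset.mul_sum,
      Finset.mul_sum]
    refine Finset.sum_congr rfl fun n hn => ?_
    obtain ⟨h2, h3⟩ := natCast_div_mem_Ioo hn
    have h4 := Complex.ofReal_norm_sq_of_conj (conj_two_mul_hurwitzZetaOdd h2 h3)
    rw [← h4, norm_mul, Complex.norm_ofNat]
    push_cast
    have : (q : ℂ) ≠ 0 := by exact_mod_cast hq0.ne'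
    field_simp
    ring
  · refine Finset.sum_eq_zero fun χ hχ => ?_
    have h1 : χ.Even := χ.even_or_odd.resolve_right (Finset.mem_filter.mp hχ).2
    rw [DirichletCharacter.sum_mul_eq_zero_of_even_of_odd h1 hg]
    simp

theorem DirichletCharacter.isPrimitive_iff_ne_one {q : ℕ} [Fact q.Prime]
    (χ : DirichletCharacter ℂ q) : χ.IsPrimitive ↔ χ ≠ 1 := by
  have hq : q.Prime := Fact.out
  rw [DirichletCharacter.isPrimitive_def, ne_eq, DirichletCharacter.eq_one_iff_conductor_eq_one]
  rcases (Nat.dvd_prime hq).mp χ.conductor_dvd_level with h | h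
  · simp [h, hq.one_lt.ne]
  · simp [h, hq.one_lt.ne']

theorem DirichletCharacter.even_one {q : ℕ} : (1 : DirichletCharacter ℂ q).Even := by
  rw [DirichletCharacter.Even, MulChar.one_apply isUnit_one.neg]

theorem oddSecondMoment_eq (q : ℕ) [Fact q.Prime] :
    (oddSecondMoment q : ℂ) = ((q : ℂ) - 1) / (4 * q) * ∑ n ∈ Finset.Ico 1 q,
      (2 * hurwitzZetaOdd (((n : ℝ) / q : ℝ) : UnitAddCircle) (1 / 2)) ^ 2 := by
  classical
  rw [← sum_odd_norm_LFunction_sq, oddSecondMoment]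
  congr 2
  refine Finset.filter_congr fun χ _ => and_iff_right_of_imp fun h => ?_
  rw [DirichletCharacter.isPrimitive_iff_ne_one]
  rintro rfl
  exact DirichletCharacter.Odd.not_even _ h DirichletCharacter.even_one

/-- The principal character is even but imprimitive, hence the correction; in the odd case none is
needed. -/
theorem evenSecondMoment_eq (q : ℕ) [Fact q.Prime] :
    (evenSecondMoment q : ℂ) = ((q : ℂ) - 1) / (4 * q) * ∑ n ∈ Finset.Ico 1 q,
      (2 * hurwitzZetaEven (((n : ℝ) / q : ℝ) : UnitAddCircle) (1 / 2)) ^ 2 -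
        ((1 - (q : ℂ) ^ (-(1 / 2) : ℂ)) * riemannZeta (1 / 2)) ^ 2 := by
  classical
  have hq : q.Prime := Fact.out
  have h1 : evenSecondMoment q + ‖DirichletCharacter.LFunction (1 : DirichletCharacter ℂ q)
      (1 / 2)‖ ^ 2 = ∑ χ : DirichletCharacter ℂ q with χ.Even,
      ‖DirichletCharacter.LFunction χ (1 / 2)‖ ^ 2 := by
    have h2 : (1 : DirichletCharacter ℂ q) ∈
        Finset.univ.filter fun χ : DirichletCharacter ℂ q => χ.Even :=
      Finset.mem_filter.mpr ⟨Finset.mem_univ _, DirichletCharacter.even_one⟩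
    rw [← Finset.sum_erase_add _ _ h2, evenSecondMoment]
    congr 2
    ext χ
    simp [DirichletCharacter.isPrimitive_iff_ne_one]
  rw [← sum_even_norm_LFunction_sq, ← h1, Complex.ofReal_add]
  have h3 : DirichletCharacter.LFunction (1 : DirichletCharacter ℂ q) (1 / 2) =
      (1 - (q : ℂ) ^ (-(1 / 2) : ℂ)) * riemannZeta (1 / 2) := by
    have h4 := DirichletCharacter.LFunctionTrivChar_eq_mul_riemannZeta (N := q) (s := 1 / 2)
      (by norm_num)
    rw [hq.primeFactors, Finset.prod_singleton] at h4
    exact h4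
  have h5 : conj ((1 - (q : ℂ) ^ (-(1 / 2) : ℂ)) * riemannZeta (1 / 2)) =
      (1 - (q : ℂ) ^ (-(1 / 2) : ℂ)) * riemannZeta (1 / 2) := by
    have h6 := conj_ofReal_cpow_neg_one_half (x := q) q.cast_nonneg
    rw [Complex.ofReal_natCast] at h6
    rw [map_mul, map_sub, map_one, h6, conj_riemannZeta_of_real conj_one_half]
  rw [h3, Complex.ofReal_norm_sq_of_conj h5]
  ring

/-! ### Calculus of asymptotic expansions in powers of `q ^ (-1/2)`. -/

/-- `q ^ (-1 / 2)`, the expansion variable. -/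
noncomputable def invSqrt (q : ℕ) : ℝ := (q : ℝ) ^ (-(1 / 2) : ℝ)

theorem invSqrt_pos {q : ℕ} (hq : 0 < q) : 0 < invSqrt q :=
  Real.rpow_pos_of_pos (by exact_mod_cast hq) _

theorem invSqrt_le_one {q : ℕ} (hq : 0 < q) : invSqrt q ≤ 1 :=
  Real.rpow_le_one_of_one_le_of_nonpos (by exact_mod_cast hq) (by norm_num)

theorem invSqrt_pow (q n : ℕ) : invSqrt q ^ n = (q : ℝ) ^ (-(n : ℝ) / 2) := by
  rw [invSqrt, ← Real.rpow_natCast, ← Real.rpow_mul q.cast_nonneg]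
  congr 1
  ring

theorem invSqrt_sq (q : ℕ) : invSqrt q ^ 2 = (q : ℝ)⁻¹ := by
  rw [invSqrt_pow, ← Real.rpow_neg_one]
  norm_num

theorem ofReal_invSqrt (q : ℕ) : (invSqrt q : ℂ) = (q : ℂ) ^ (-(1 / 2) : ℂ) := by
  rw [invSqrt, Complex.ofReal_cpow q.cast_nonneg]
  norm_num

theorem natCast_cpow_eq_invSqrt_pow (q n : ℕ) {s : ℂ} (hs : s = -(n / 2)) :
    (q : ℂ) ^ s = (invSqrt q : ℂ) ^ n := by
  rw [← Complex.ofReal_pow, invSqrt_pow, Complex.ofReal_cpow q.cast_nonneg, hs]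
  push_cast
  rw [neg_div]

/-- `f q` has the asymptotic expansion `∑ c n * q ^ (-n / 2)` along the primes. -/
def HasInvSqrtExpansion (f c : ℕ → ℂ) : Prop :=
  ∀ K : ℕ, ∃ C : ℝ, ∀ q : ℕ, q.Prime →
    ‖f q - ∑ n ∈ Finset.range K, c n * (invSqrt q : ℂ) ^ n‖ ≤ C * invSqrt q ^ K

/-- A partial sum longer than the order of its error is harmless: since `invSqrt q ≤ 1`, every
surplus term is itself `O(invSqrt q ^ K)`. -/
theorem hasInvSqrtExpansion_of_exists_le {f c : ℕ → ℂ}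
    (h : ∀ K : ℕ, ∃ S, K ≤ S ∧ ∃ C : ℝ, ∀ q : ℕ, q.Prime →
      ‖f q - ∑ n ∈ Finset.range S, c n * (invSqrt q : ℂ) ^ n‖ ≤ C * invSqrt q ^ K) :
    HasInvSqrtExpansion f c := fun K => by
  obtain ⟨S, hKS, C, hC⟩ := h K
  refine ⟨C + ∑ n ∈ Finset.Ico K S, ‖c n‖, fun q hq => ?_⟩
  have hx := invSqrt_pos hq.pos
  have hsplit := Finset.sum_range_add_sum_Ico (fun n => c n * (invSqrt q : ℂ) ^ n) hKS
  have htail : ‖∑ n ∈ Finset.Ico K S, c n * (invSqrt q : ℂ) ^ n‖ ≤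
      (∑ n ∈ Finset.Ico K S, ‖c n‖) * invSqrt q ^ K := by
    rw [Finset.sum_mul]
    refine (norm_sum_le _ _).trans (Finset.sum_le_sum fun n hn => ?_)
    rw [norm_mul, norm_pow, Complex.norm_real, Real.norm_of_nonneg hx.le]
    exact mul_le_mul_of_nonneg_left (pow_le_pow_of_le_one hx.le (invSqrt_le_one hq.pos)
      (Finset.mem_Ico.mp hn).1) (norm_nonneg _)
  calc ‖f q - ∑ n ∈ Finset.range K, c n * (invSqrt q : ℂ) ^ n‖
      = ‖(f q - ∑ n ∈ Finset.range S, c n * (invSqrt q : ℂ) ^ n) +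
          ∑ n ∈ Finset.Ico K S, c n * (invSqrt q : ℂ) ^ n‖ := by
        rw [← hsplit]; congr 1; ring
    _ ≤ _ := norm_add_le _ _
    _ ≤ C * invSqrt q ^ K + (∑ n ∈ Finset.Ico K S, ‖c n‖) * invSqrt q ^ K :=
        add_le_add (hC q hq) htail
    _ = _ := by ring

theorem HasInvSqrtExpansion.sub {f g c d : ℕ → ℂ} (hf : HasInvSqrtExpansion f c)
    (hg : HasInvSqrtExpansion g d) :
    HasInvSqrtExpansion (fun q => f q - g q) fun n => c n - d n := fun K => by
  obtain ⟨C, hC⟩ := hf K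
  obtain ⟨D, hD⟩ := hg K
  refine ⟨C + D, fun q hq => ?_⟩
  have : f q - g q - ∑ n ∈ Finset.range K, (c n - d n) * (invSqrt q : ℂ) ^ n =
      (f q - ∑ n ∈ Finset.range K, c n * (invSqrt q : ℂ) ^ n) -
        (g q - ∑ n ∈ Finset.range K, d n * (invSqrt q : ℂ) ^ n) := by
    simp only [sub_mul, Finset.sum_sub_distrib]
    ring
  rw [this, add_mul]
  exact (norm_sub_le _ _).trans (add_le_add (hC q hq) (hD q hq))

theorem HasInvSqrtExpansion.const_mul {f c : ℕ → ℂ} (hf : HasInvSqrtExpansion f c) (a : ℂ) :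
    HasInvSqrtExpansion (fun q => a * f q) fun n => a * c n := fun K => by
  obtain ⟨C, hC⟩ := hf K
  refine ⟨‖a‖ * C, fun q hq => ?_⟩
  simp only [mul_assoc, ← Finset.mul_sum, ← mul_sub, norm_mul]
  exact mul_le_mul_of_nonneg_left (hC q hq) (norm_nonneg a)

theorem HasInvSqrtExpansion.invSqrt_mul {f c : ℕ → ℂ} (hf : HasInvSqrtExpansion f c) :
    HasInvSqrtExpansion (fun q => invSqrt q * f q) (mulVarCoeff c) :=
  hasInvSqrtExpansion_of_exists_le fun K => by
    obtain ⟨C, hC⟩ := hf K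
    refine ⟨K + 1, K.le_succ, C, fun q hq => ?_⟩
    have hx := invSqrt_pos hq.pos
    have h : (invSqrt q : ℂ) * f q -
        ∑ n ∈ Finset.range (K + 1), mulVarCoeff c n * (invSqrt q : ℂ) ^ n =
        invSqrt q * (f q - ∑ n ∈ Finset.range K, c n * (invSqrt q : ℂ) ^ n) := by
      rw [Finset.sum_range_succ', mul_sub, Finset.mul_sum]
      simp only [mulVarCoeff, zero_mul, add_zero]
      congr 1
      exact Finset.sum_congr rfl fun n _ => by ring
    rw [h, norm_mul, Complex.norm_real, Real.norm_of_nonneg hx.le]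
    exact (mul_le_of_le_one_left (norm_nonneg _) (invSqrt_le_one hq.pos)).trans (hC q hq)

/-- Consecutive singular exponents differ by `2` in `q`, that is by `4` in `invSqrt q`, so the
coefficient sequence is supported on the progression `4 * j + m`. -/
theorem sum_range_extend_mul_pow (b : ℕ → ℂ) (m S : ℕ) (x : ℂ) :
    ∑ n ∈ Finset.range (4 * S + m), Function.extend (fun j => 4 * j + m) b 0 n * x ^ n =
      ∑ j ∈ Finset.range S, b j * x ^ (4 * j + m) := by
  have hinj : Function.Injective fun j : ℕ => 4 * j + m := fun i j h => by
    simp only at h; omega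
  induction S with
  | zero =>
    refine Finset.sum_eq_zero fun n hn => ?_
    rw [Finset.mem_range] at hn
    rw [Function.extend_apply' _ _ _ (by rintro ⟨j, hj⟩; omega), Pi.zero_apply,
      zero_mul]
  | succ S ih =>
    have h0 : Function.extend (fun j => 4 * j + m) b 0 (4 * S + m) = b S :=
      hinj.extend_apply b 0 S
    have h1 : ∀ i, 0 < i → i < 4 →
        Function.extend (fun j => 4 * j + m) b 0 (4 * S + m + i) = 0 := fun i hi hi4 => by
      rw [Function.extend_apply' _ _ _ (by rintro ⟨j, hj⟩; omega), Pi.zero_apply]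
    rw [show 4 * (S + 1) + m = 4 * S + m + 1 + 1 + 1 + 1 by ring, Finset.sum_range_succ,
      Finset.sum_range_succ, Finset.sum_range_succ, Finset.sum_range_succ, ih, h0,
      h1 1 (by norm_num) (by norm_num), Finset.sum_range_succ]
    have h2 := h1 2 (by norm_num) (by norm_num)
    have h3 := h1 3 (by norm_num) (by norm_num)
    rw [show 4 * S + m + 1 + 1 = 4 * S + m + 2 by ring, h2,
      show 4 * S + m + 2 + 1 = 4 * S + m + 3 by ring, h3]
    ring

theorem natCast_div_pow_le_invSqrt_pow {q : ℕ} (hq : 0 < q) (K : ℕ) :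
    (q : ℝ) / (q : ℝ) ^ (2 * (K + 1)) ≤ invSqrt q ^ K := by
  have hq0 : (q : ℝ) ≠ 0 := by exact_mod_cast hq.ne'
  have h : (q : ℝ) / (q : ℝ) ^ (2 * (K + 1)) = invSqrt q ^ (2 * (2 * K + 1)) := by
    rw [pow_mul (invSqrt q), invSqrt_sq q, inv_pow, show 2 * (K + 1) = 2 * K + 1 + 1 by ring,
      pow_succ]
    field_simp
  rw [h]
  exact pow_le_pow_of_le_one (invSqrt_pos hq).le (invSqrt_le_one hq) (by omega)

theorem hasInvSqrtExpansion_of_sparse {f b : ℕ → ℂ} (m : ℕ)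
    (h : ∀ M : ℕ, ∃ S, M ≤ S ∧ ∃ C : ℝ, ∀ q : ℕ, q.Prime →
      ‖f q - ∑ j ∈ Finset.range S, b j * (invSqrt q : ℂ) ^ (4 * j + m)‖ ≤
        C * q / (q : ℝ) ^ (2 * M)) :
    HasInvSqrtExpansion f (Function.extend (fun j => 4 * j + m) b 0) :=
  hasInvSqrtExpansion_of_exists_le fun K => by
    obtain ⟨S, hS, C, hC⟩ := h (K + 1)
    refine ⟨4 * S + m, by omega, |C|, fun q hq => ?_⟩
    rw [sum_range_extend_mul_pow]
    refine (hC q hq).trans ?_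
    rw [mul_div_assoc]
    have h0 : (0 : ℝ) ≤ q / (q : ℝ) ^ (2 * (K + 1)) := by positivity
    exact (mul_le_mul_of_nonneg_right (le_abs_self C) h0).trans
      (mul_le_mul_of_nonneg_left (natCast_div_pow_le_invSqrt_pow hq.pos K) (abs_nonneg C))

/-- Coefficients of `(1 - x ^ 2) / 4 * ∑ b j * x ^ (4 * j + m)`. -/
noncomputable def momentCoeff (m : ℕ) (b : ℕ → ℂ) (n : ℕ) : ℂ :=
  1 / 4 * (Function.extend (fun j => 4 * j + m) b 0 n -
    mulVarCoeff (mulVarCoeff (Function.extend (fun j => 4 * j + m) b 0)) n)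

/-- With `m > 0` the expansion has no constant term, so the final sums start at `n = 1`. -/
theorem momentCoeff_zero {m : ℕ} (hm : 0 < m) (b : ℕ → ℂ) : momentCoeff m b 0 = 0 := by
  rw [momentCoeff, Function.extend_apply' _ _ _ (by rintro ⟨j, hj⟩; omega)]
  simp [mulVarCoeff]

theorem hasInvSqrtExpansion_momentCoeff {f b : ℕ → ℂ} {m : ℕ}
    (h : HasInvSqrtExpansion f (Function.extend (fun j => 4 * j + m) b 0)) :
    HasInvSqrtExpansion (fun q => 1 / 4 * (f q - invSqrt q * (invSqrt q * f q)))
      (momentCoeff m b) :=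
  (h.sub h.invSqrt_mul.invSqrt_mul).const_mul (1 / 4)

theorem HasInvSqrtExpansion.exists_real {f c : ℕ → ℂ} (hf : HasInvSqrtExpansion f c)
    (hc : c 0 = 0) (N : ℕ) : ∃ C : ℝ, ∀ q : ℕ, q.Prime →
      |(f q).re - ∑ n ∈ Finset.Icc 1 N, (c n).re * (q : ℝ) ^ (-(n : ℝ) / 2)| ≤
        C * (q : ℝ) ^ (-((N : ℝ) + 1) / 2) := by
  obtain ⟨C, hC⟩ := hf (N + 1)
  refine ⟨C, fun q hq => ?_⟩
  have h := (Complex.abs_re_le_norm _).trans (hC q hq)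
  rw [invSqrt_pow, Nat.cast_succ] at h
  convert! h using 2
  rw [Complex.sub_re, Complex.re_sum, Finset.range_eq_Ico, Finset.sum_eq_sum_Ico_succ_bot (by omega),
    hc, zero_mul, Complex.zero_re, zero_add, zero_add]
  congr 1
  refine Finset.sum_congr rfl fun n _ => ?_
  rw [← Complex.ofReal_pow, Complex.re_mul_ofReal, invSqrt_pow]

/-- The term `j = 0` has exponent `+1/2` and joins the main part as `8 * ζ(1/2) ^ 2 * q ^ (1/2)`;
the others have exponent `-(4 * j + 3) / 2` after reindexing. -/
theorem hasInvSqrtExpansion_even :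
    HasInvSqrtExpansion (fun q => ∑ n ∈ Finset.Ico 1 q,
        (2 * hurwitzZetaEven (((n : ℝ) / q : ℝ) : UnitAddCircle) (1 / 2)) ^ 2 -
      (leadingTerm (regularizedIntegral 0 (1 / 2)) q - 4 * riemannZeta (1 / 2) ^ 2 +
        8 * riemannZeta (1 / 2) ^ 2 * (q : ℂ) ^ (1 / 2 : ℂ)))
      (Function.extend (fun j => 4 * j + 3) (fun j => 2 * (2 * evenCoeff (j + 1)) *
        riemannZeta (singularExponent 0 (j + 1))) 0) :=
  hasInvSqrtExpansion_of_sparse 3 fun M => by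
    obtain ⟨C, hC⟩ := exists_even_expansion M
    refine ⟨M, le_rfl, C, fun q hq => ?_⟩
    convert! hC q hq using 2
    rw [Finset.sum_range_succ', evenCoeff_zero]
    have h0 : singularExponent 0 0 = 1 / 2 := by simp [singularExponent]
    have h1 : ∀ j : ℕ, (q : ℂ) ^ singularExponent 0 (j + 1) = (invSqrt q : ℂ) ^ (4 * j + 3) :=
      fun j => natCast_cpow_eq_invSqrt_pow _ _ (by rw [singularExponent]; push_cast; ring)
    simp only [h0, h1]
    ring

theorem hasInvSqrtExpansion_odd :
    HasInvSqrtExpansion (fun q => ∑ n ∈ Finset.Ico 1 q,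
        (2 * hurwitzZetaOdd (((n : ℝ) / q : ℝ) : UnitAddCircle) (1 / 2)) ^ 2 -
      leadingTerm (regularizedIntegral 1 (1 / 2)) q)
      (Function.extend (fun j => 4 * j + 1) (fun j => 2 * (2 * signedCoeff 1 (1 / 2) j) *
        riemannZeta (singularExponent 1 j)) 0) :=
  hasInvSqrtExpansion_of_sparse 1 fun M => by
    obtain ⟨C, hC⟩ := exists_odd_expansion M
    refine ⟨M + 1, M.le_succ, C, fun q hq => ?_⟩
    convert! hC q hq using 2
    have h1 : ∀ j : ℕ, (q : ℂ) ^ singularExponent 1 j = (invSqrt q : ℂ) ^ (4 * j + 1) :=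
      fun j => natCast_cpow_eq_invSqrt_pow _ _ (by rw [singularExponent]; push_cast; ring)
    simp only [h1]
    ring

/-! ### Assembly of the two asymptotic formulas. -/

theorem leadingTerm_eq {q : ℕ} (hq : 0 < q) (t : ℝ) :
    leadingTerm ((t : ℂ) - (Real.log (4 * Real.pi) : ℝ)) q =
      2 * q * ((Real.log (q / (8 * Real.pi)) + Real.eulerMascheroniConstant + t : ℝ) : ℂ) := by
  have hq0 : (q : ℝ) ≠ 0 := by exact_mod_cast hq.ne'
  have hpi := Real.pi_pos
  have h : Real.log (q / (8 * Real.pi)) = Real.log q - Real.log (4 * Real.pi) - Real.log 2 := by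
    rw [Real.log_div hq0 (by positivity), show 8 * Real.pi = 4 * Real.pi * 2 by ring,
      Real.log_mul (by positivity) two_ne_zero]
    ring
  rw [leadingTerm, h]
  push_cast
  ring

theorem theorem1 :
    (∃ c : ℕ → ℝ, ∀ N : ℕ, 1 ≤ N → ∃ C : ℝ, ∀ (q : ℕ) [Fact q.Prime], Odd q →
      ‖(evenSecondMoment q : ℂ) -
        ((((q : ℝ) - 1) / 2 *
            (Real.log ((q : ℝ) / (8 * Real.pi)) + Real.eulerMascheroniConstant - Real.pi / 2) : ℝ)
          + 2 * riemannZeta (1 / 2) ^ 2 * (((q : ℝ) ^ (1 / 2 : ℝ) : ℝ) : ℂ)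
          - 2 * riemannZeta (1 / 2) ^ 2
          + ((∑ n ∈ Finset.Icc 1 N, c n * (q : ℝ) ^ (-(n : ℝ) / 2) : ℝ) : ℂ))‖
        ≤ C * (q : ℝ) ^ (-((N : ℝ) + 1) / 2)) ∧
    (∃ c' : ℕ → ℝ, ∀ N : ℕ, 1 ≤ N → ∃ C : ℝ, ∀ (q : ℕ) [Fact q.Prime], Odd q →
      |oddSecondMoment q -
        (((q : ℝ) - 1) / 2 *
            (Real.log ((q : ℝ) / (8 * Real.pi)) + Real.eulerMascheroniConstant + Real.pi / 2)
          + ∑ n ∈ Finset.Icc 1 N, c' n * (q : ℝ) ^ (-(n : ℝ) / 2))|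
        ≤ C * (q : ℝ) ^ (-((N : ℝ) + 1) / 2)) := by
  constructor
  · obtain ⟨c, hc0, hexp⟩ : ∃ c : ℕ → ℂ, c 0 = 0 ∧ HasInvSqrtExpansion _ c :=
      ⟨_, momentCoeff_zero (by norm_num) _,
        hasInvSqrtExpansion_momentCoeff hasInvSqrtExpansion_even⟩
    refine ⟨fun n => (c n).re, fun N _ => ?_⟩
    obtain ⟨C, hC⟩ := hexp.exists_real hc0 N
    refine ⟨C, fun q hq _ => ?_⟩
    have hq0 : 0 < q := hq.out.pos
    have hqC : (q : ℂ) ≠ 0 := by exact_mod_cast hq0.ne'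
    have hC := hC q hq.out
    set z : ℂ := (evenSecondMoment q : ℂ) -
      ((((q : ℝ) - 1) / 2 *
          (Real.log ((q : ℝ) / (8 * Real.pi)) + Real.eulerMascheroniConstant - Real.pi / 2) : ℝ)
        + 2 * riemannZeta (1 / 2) ^ 2 * (((q : ℝ) ^ (1 / 2 : ℝ) : ℝ) : ℂ)
        - 2 * riemannZeta (1 / 2) ^ 2) with hz
    -- As `z` is real, real parts of the complex coefficients may serve as the constants.
    have hzr : ((z.re : ℝ) : ℂ) = z := by
      rw [← Complex.conj_eq_iff_re, hz]
      simp only [map_sub, map_add, map_mul, map_pow, Complex.conj_ofReal, map_ofNat,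
        conj_riemannZeta_of_real conj_one_half]
    have hsq : (invSqrt q : ℂ) * invSqrt q = (q : ℂ)⁻¹ := by
      rw [← pow_two, ← Complex.ofReal_pow, invSqrt_sq q, Complex.ofReal_inv,
        Complex.ofReal_natCast]
    have hhalf : (((q : ℝ) ^ (1 / 2 : ℝ) : ℝ) : ℂ) = (q : ℂ) ^ (1 / 2 : ℂ) := by
      rw [Complex.ofReal_cpow q.cast_nonneg]; norm_num
    have hinv : (invSqrt q : ℂ) * (q : ℂ) ^ (1 / 2 : ℂ) = 1 := by
      rw [ofReal_invSqrt, ← Complex.cpow_add _ _ hqC]; norm_num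
    have hlead := leadingTerm_eq hq0 (-Real.pi / 2)
    rw [show (((-Real.pi / 2 : ℝ)) : ℂ) = -(Real.pi : ℂ) / 2 by push_cast; ring,
      ← regularizedIntegral_even] at hlead
    -- The prefactor `(q - 1) / (4 * q)` is `(1 - invSqrt q ^ 2) / 4`. Its product with the `ζ(1/2)
    -- ^ 2` terms, minus the principal character's term, is exactly `2 * ζ(1/2) ^ 2 * (q ^ (1/2) -
    -- 1)`: the lower powers cancel.
    have hval : z = 1 / 4 * ((∑ n ∈ Finset.Ico 1 q,
        (2 * hurwitzZetaEven (((n : ℝ) / q : ℝ) : UnitAddCircle) (1 / 2)) ^ 2 -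
      (leadingTerm (regularizedIntegral 0 (1 / 2)) q - 4 * riemannZeta (1 / 2) ^ 2 +
        8 * riemannZeta (1 / 2) ^ 2 * (q : ℂ) ^ (1 / 2 : ℂ))) - invSqrt q * (invSqrt q *
        (∑ n ∈ Finset.Ico 1 q,
          (2 * hurwitzZetaEven (((n : ℝ) / q : ℝ) : UnitAddCircle) (1 / 2)) ^ 2 -
      (leadingTerm (regularizedIntegral 0 (1 / 2)) q - 4 * riemannZeta (1 / 2) ^ 2 +
        8 * riemannZeta (1 / 2) ^ 2 * (q : ℂ) ^ (1 / 2 : ℂ))))) := by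
      rw [hz, evenSecondMoment_eq, hlead, hhalf, ← ofReal_invSqrt, ← mul_assoc (invSqrt q : ℂ), hsq]
      set T := ∑ n ∈ Finset.Ico 1 q,
        (2 * hurwitzZetaEven (((n : ℝ) / q : ℝ) : UnitAddCircle) (1 / 2)) ^ 2
      set w := (q : ℂ) ^ (1 / 2 : ℂ)
      set ζ := riemannZeta (1 / 2)
      have hx : (q : ℂ)⁻¹ * w = invSqrt q := by rw [← hsq, mul_assoc, hinv, mul_one]
      have h1 : (q : ℂ)⁻¹ * q = 1 := inv_mul_cancel₀ hqC
      have h2 : ((q : ℂ) - 1) / (4 * q) * T = 1 / 4 * (T - (q : ℂ)⁻¹ * T) := by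
        field_simp
      rw [h2]
      push_cast
      generalize (q : ℂ)⁻¹ = r at *
      generalize ((Real.log (q / (8 * Real.pi)) : ℝ) : ℂ) = l
      linear_combination (-(ζ ^ 2)) * hsq - 2 * ζ ^ 2 * hx +
        (-1 / 2) * (l + Real.eulerMascheroniConstant - Real.pi / 2) * h1
    rw [← hval] at hC
    rw [← sub_sub, ← hz, ← hzr, ← Complex.ofReal_sub, Complex.norm_real]
    exact hC
  · obtain ⟨c, hc0, hexp⟩ : ∃ c : ℕ → ℂ, c 0 = 0 ∧ HasInvSqrtExpansion _ c :=
      ⟨_, momentCoeff_zero (by norm_num) _,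
        hasInvSqrtExpansion_momentCoeff hasInvSqrtExpansion_odd⟩
    refine ⟨fun n => (c n).re, fun N _ => ?_⟩
    obtain ⟨C, hC⟩ := hexp.exists_real hc0 N
    refine ⟨C, fun q hq _ => ?_⟩
    have hq0 : 0 < q := hq.out.pos
    have hqC : (q : ℂ) ≠ 0 := by exact_mod_cast hq0.ne'
    have hC := hC q hq.out
    have hsq : (invSqrt q : ℂ) * invSqrt q = (q : ℂ)⁻¹ := by
      rw [← pow_two, ← Complex.ofReal_pow, invSqrt_sq q, Complex.ofReal_inv,
        Complex.ofReal_natCast]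
    have hlead := leadingTerm_eq hq0 (Real.pi / 2)
    rw [show (((Real.pi / 2 : ℝ)) : ℂ) = (Real.pi : ℂ) / 2 by push_cast; ring,
      ← regularizedIntegral_odd] at hlead
    have hval : ((oddSecondMoment q - ((q : ℝ) - 1) / 2 *
        (Real.log ((q : ℝ) / (8 * Real.pi)) + Real.eulerMascheroniConstant + Real.pi / 2) : ℝ) :
          ℂ) = 1 / 4 * ((∑ n ∈ Finset.Ico 1 q,
        (2 * hurwitzZetaOdd (((n : ℝ) / q : ℝ) : UnitAddCircle) (1 / 2)) ^ 2 -
      leadingTerm (regularizedIntegral 1 (1 / 2)) q) - invSqrt q * (invSqrt q *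
        (∑ n ∈ Finset.Ico 1 q,
          (2 * hurwitzZetaOdd (((n : ℝ) / q : ℝ) : UnitAddCircle) (1 / 2)) ^ 2 -
      leadingTerm (regularizedIntegral 1 (1 / 2)) q))) := by
      rw [Complex.ofReal_sub, oddSecondMoment_eq, hlead, ← mul_assoc (invSqrt q : ℂ), hsq]
      set T := ∑ n ∈ Finset.Ico 1 q,
        (2 * hurwitzZetaOdd (((n : ℝ) / q : ℝ) : UnitAddCircle) (1 / 2)) ^ 2
      have h1 : (q : ℂ)⁻¹ * q = 1 := inv_mul_cancel₀ hqC
      have h2 : ((q : ℂ) - 1) / (4 * q) * T = 1 / 4 * (T - (q : ℂ)⁻¹ * T) := by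
        field_simp
      rw [h2]
      push_cast
      generalize (q : ℂ)⁻¹ = r at *
      generalize ((Real.log (q / (8 * Real.pi)) : ℝ) : ℂ) = l
      linear_combination (-1 / 2) * (l + Real.eulerMascheroniConstant + Real.pi / 2) * h1
    rw [← hval, Complex.ofReal_re, sub_sub] at hC
    exact hC
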